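/- Let $\omega=e^{2\pi i/3}$, $\tau=e^{4\pi i/3}$, and on $\mathbb C^3$ let $X|j\rangle=|j+1 \bmod 3\rangle$, $Z|j\rangle=\omega^j|j\rangle$. For $u=(a_1,a_2)\in\mathbb Z_3^2$ put $T_u=\tau^{-a_1a_2}Z^{a_1}X^{a_2}$, and for $n$ qutrits and $u=(u_1,\dots,u_n)\in(\mathbb Z_3^2)^n$ put $T_u=T_{u_1}\otimes\cdots\otimes T_{u_n}$, $A_0=3^{-n}\sum_u T_u$, $A_u=T_uA_0T_u^\dagger$. The discrete Wigner function of an operator $V$ on $(\mathbb C^3)^{\otimes n}$ is $W_V(u)=3^{-n}\operatorname{tr}(A_uV)$, its Wigner trace norm is $\|V\|_{W,1}=\sum_u|W_V(u)|$, and its mana is $\mathcal M(V)=\log_2\|V\|_{W,1}$. Let $\mathcal W=\{\sigma\ge 0:\ \mathcal M(\sigma)\le 0\}$. Let $\mathrm{STAB}$ be the convex hull of the pure stabilizer states $U|0\cdots0\rangle\langle 0\cdots 0|U^\dagger$, where $U$ ranges over the Clifford unitaries, i.e. the unitaries such that for every $u$ there are $\theta\in\mathbb R$ and $u'$ with $UT_uU^\dagger=e^{i\theta}T_{u'}$.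 Let $D(\rho\|\sigma)=\operatorname{tr}\rho(\log_2\rho-\log_2\sigma)$ if $\operatorname{supp}\rho\subseteq\operatorname{supp}\sigma$ and $+\infty$ otherwise; $D_0(\rho\|\sigma)=-\log_2\operatorname{tr}P_\rho\sigma$, with $P_\rho$ the projection onto the support of $\rho$; and $D_{\max}(\rho\|\sigma)=\min\{\lambda\in\mathbb R:\rho\le 2^\lambda\sigma\}$ ($+\infty$ if there is no such $\lambda$). Define, for a state $\rho$ of $n$ qutrits, $$\theta(\rho)=\min_{\sigma\in\mathcal W}D(\rho\|\sigma),\quad \theta_{\min}(\rho)=\min_{\sigma\in\mathcal W}D_0(\rho\|\sigma),\quad \theta_{\max}(\rho)=\min_{\sigma\in\mathcal W}D_{\max}(\rho\|\sigma),\quad R_{\mathcal M}(\rho)=\min_{\sigma\in\mathrm{STAB}}D(\rho\|\sigma),$$ and, for a one-qutrit state $\rho$, $\theta^\infty(\rho)=\lim_{n\to\infty}\frac1n\theta(\rho^{\otimes n})$ and $R^\infty_{\mathcal M}(\rho)=\lim_{n\to\infty}\frac1nR_{\mathcal M}(\rho^{\otimes n})$. Let $\mathbb S,\mathbb N,H_+,T$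 be the projectors onto the qutrit vectors $$|\mathbb S\rangle=\frac{|1\rangle-|2\rangle}{\sqrt2},\quad |\mathbb N\rangle=\frac{-|0\rangle+2|1\rangle-|2\rangle}{\sqrt6},\quad |H_+\rangle=\frac{(1+\sqrt3)|0\rangle+|1\rangle+|2\rangle}{\sqrt{2(3+\sqrt3)}},\quad |T\rangle=\frac{\xi|0\rangle+|1\rangle+\xi^{-1}|2\rangle}{\sqrt3},\quad \xi=e^{2\pi i/9}$$ ($|H_+\rangle$ is the $+1$-eigenvector of the qutrit Hadamard gate). Then the limits in the following equalities exist and $$\theta_{\min}(\mathbb S)=\theta^\infty(\mathbb S)=\theta_{\max}(\mathbb S)=\log_2(5/3),$$ $$\theta_{\min}(\mathbb N)=\theta^\infty(\mathbb N)=\theta_{\max}(\mathbb N)=R^\infty_{\mathcal M}(\mathbb N)=\log_2(3/2),$$ $$\theta_{\min}(H_+)=\theta^\infty(H_+)=\theta_{\max}(H_+)=R^\infty_{\mathcal M}(H_+)=\log_2(3-\sqrt3),$$ $$\theta_{\min}(T)=\theta^\infty(T)=\theta_{\max}(T)=\log_2\bigl(1+2\sin(\pi/18)\bigr).$$ -/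

import Mathlib

open Matrix Filter Topology
open scoped ComplexOrder

noncomputable section

/-! ### Registers of `n` qudits, Heisenberg-Weyl operators, discrete Wigner function

The computational basis of one qudit is indexed by `ZMod d` (`d` an odd prime; `d = 3` for qutrits)
and that of `n` qudits by `Fin n → ZMod d`. -/

/-- Operators on `n` qudits, in the computational basis. -/
abbrev QOp (d n : ℕ) : Type := Matrix (Fin n → ZMod d) (Fin n → ZMod d) ℂ

/-- The discrete phase space of `n` qudits. -/
abbrev PhaseSpace (d n : ℕ) : Type := Fin n → ZMod d × ZMod d

/-- The tensor power `ρ^{⊗ n}` of a one-qudit operator. The operator `ρ` itself, as an operator on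
a register of one qudit, is `tensorPow ρ 1`. -/
def tensorPow {d : ℕ} (ρ : Matrix (ZMod d) (ZMod d) ℂ) (n : ℕ) : QOp d n :=
  Matrix.of fun i j => ∏ k, ρ (i k) (j k)

/-- `ω = e^{2πi/d}`. -/
def omega (d : ℕ) : ℂ := Complex.exp (2 * Real.pi * Complex.I / d)

/-- `τ = e^{(d+1)πi/d}`. -/
def tau (d : ℕ) : ℂ := Complex.exp ((d + 1) * Real.pi * Complex.I / d)

/-- The shift operator, `X|j⟩ = |j+1⟩`. -/
def shiftX (d : ℕ) : Matrix (ZMod d) (ZMod d) ℂ :=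
  Matrix.of fun i j => if i = j + 1 then 1 else 0

/-- The boost operator, `Z|j⟩ = ω^j|j⟩`. -/
def boostZ (d : ℕ) : Matrix (ZMod d) (ZMod d) ℂ :=
  Matrix.diagonal fun j => omega d ^ j.val

/-- The one-qudit Heisenberg-Weyl operator `T_u = τ^{-a₁a₂} Z^{a₁} X^{a₂}`, `u = (a₁, a₂)`. -/
def weylOne (d : ℕ) [NeZero d] (u : ZMod d × ZMod d) : Matrix (ZMod d) (ZMod d) ℂ :=
  (tau d ^ (u.1.val * u.2.val))⁻¹ • (boostZ d ^ u.1.val * shiftX d ^ u.2.val)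

/-- Heisenberg-Weyl operators of `n` qudits: tensor products of those of the single qudits. -/
def weyl {d n : ℕ} [NeZero d] (u : PhaseSpace d n) : QOp d n :=
  Matrix.of fun i j => ∏ k, weylOne d (u k) (i k) (j k)

/-- `A_0 = (1 / dim) ∑_u T_u`. -/
def phasePointZero (d n : ℕ) [NeZero d] : QOp d n :=
  ((d : ℂ) ^ n)⁻¹ • ∑ u : PhaseSpace d n, weyl u

/-- The phase-space point operators `A_u = T_u A_0 T_u†`. -/
def phasePoint {d n : ℕ} [NeZero d] (u : PhaseSpace d n) : QOp d n :=
  weyl u * phasePointZero d n * (weyl u)ᴴ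

/-- The discrete Wigner function `W_V(u) = tr (A_u V) / dim`. -/
def wigner {d n : ℕ} [NeZero d] (V : QOp d n) (u : PhaseSpace d n) : ℂ :=
  (phasePoint u * V).trace / (d : ℂ) ^ n

/-- The Wigner trace norm `‖V‖_{W,1} = ∑_u |W_V(u)|`. -/
def wignerTraceNorm {d n : ℕ} [NeZero d] (V : QOp d n) : ℝ :=
  ∑ u : PhaseSpace d n, ‖wigner V u‖

/-- The mana `log₂ ‖V‖_{W,1}`, with the value `-∞` when the Wigner trace norm is zero. -/
def mana {d n : ℕ} [NeZero d] (V : QOp d n) : EReal :=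
  if wignerTraceNorm V = 0 then ⊥ else ((Real.logb 2 (wignerTraceNorm V) : ℝ) : EReal)

/-- The set `𝒲` of positive semidefinite operators with non-positive mana. -/
def nonposMana (d n : ℕ) [NeZero d] : Set (QOp d n) :=
  {σ | mana σ ≤ 0 ∧ σ.PosSemidef}

/-! ### Stabilizer states -/

/-- Clifford operators: the unitaries that map every Heisenberg-Weyl operator under conjugation to
a Heisenberg-Weyl operator, up to a phase. -/
def IsClifford {d n : ℕ} [NeZero d] (U : QOp d n) : Prop :=
  U ∈ Matrix.unitaryGroup (Fin n → ZMod d) ℂ ∧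
    ∀ u : PhaseSpace d n, ∃ (θ : ℝ) (u' : PhaseSpace d n),
      U * weyl u * Uᴴ = Complex.exp (Complex.I * θ) • weyl u'

/-- The projector `|0⟩⟨0|` onto the all-zero computational basis vector. -/
def projZero (d n : ℕ) : QOp d n := Matrix.single 0 0 1

/-- The set `STAB`: the convex hull of the pure stabilizer states `U|0⟩⟨0|U†`, `U` Clifford. -/
def stabStates (d n : ℕ) [NeZero d] : Set (QOp d n) :=
  convexHull ℝ {S | ∃ U : QOp d n, IsClifford U ∧ S = U * projZero d n * Uᴴ}

/-! ### Divergences (base-two logarithms, values in the extended reals) -/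

section Divergences

variable {α : Type*} [Fintype α] [DecidableEq α]

open Classical in
/-- The quantum relative entropy `D(ρ‖σ) = tr (ρ (log₂ ρ - log₂ σ))` if the support of `ρ` is
contained in that of `σ` (that is, `ker σ ⊆ ker ρ`), and `+∞` otherwise. The logarithms are taken
by functional calculus on the supports (`Real.logb 2 0 = 0`). -/
def relEntropy (ρ σ : Matrix α α ℂ) : EReal :=
  if ∀ v : α → ℂ, σ *ᵥ v = 0 → ρ *ᵥ v = 0 then
    (((ρ * (cfc (Real.logb 2) ρ - cfc (Real.logb 2) σ)).trace.re : ℝ) : EReal)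
  else ⊤

/-- The projection onto the support of a Hermitian `ρ`: the spectral projection for the nonzero
eigenvalues. -/
def supportProj (ρ : Matrix α α ℂ) : Matrix α α ℂ :=
  cfc (fun x : ℝ => if x = 0 then 0 else 1) ρ

/-- The Petz-Rényi relative entropy of order zero, `D₀(ρ‖σ) = -log₂ tr (P_ρ σ)`, which is `+∞`
when the trace vanishes. -/
def relEntropyZero (ρ σ : Matrix α α ℂ) : EReal :=
  if (supportProj ρ * σ).trace.re = 0 then ⊤
  else ((-Real.logb 2 (supportProj ρ * σ).trace.re : ℝ) : EReal)

/-- The max-relative entropy, `D_max(ρ‖σ) = min {λ : ρ ≤ 2^λ σ}`, which is `+∞` when there is no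
such `λ`. -/
def relEntropyMax (ρ σ : Matrix α α ℂ) : EReal :=
  ⨅ (l : ℝ) (_ : ((((2 : ℝ) ^ l : ℝ) : ℂ) • σ - ρ).PosSemidef), (l : EReal)

end Divergences

/-! ### Thauma measures and the relative entropy of magic -/

section Measures

variable {d n : ℕ} [NeZero d]

/-- The thauma `θ(ρ)`. -/
def thauma (ρ : QOp d n) : EReal := ⨅ σ ∈ nonposMana d n, relEntropy ρ σ

/-- The min-thauma `θ_min(ρ)`. -/
def thaumaMin (ρ : QOp d n) : EReal := ⨅ σ ∈ nonposMana d n, relEntropyZero ρ σ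

/-- The max-thauma `θ_max(ρ)`. -/
def thaumaMax (ρ : QOp d n) : EReal := ⨅ σ ∈ nonposMana d n, relEntropyMax ρ σ

/-- The relative entropy of magic `R_M(ρ)`. -/
def relEntropyMagic (ρ : QOp d n) : EReal := ⨅ σ ∈ stabStates d n, relEntropy ρ σ

/-- The regularized thauma `lim θ(ρ^{⊗n}) / n` of a one-qudit state exists and equals `v`. -/
def HasRegThauma (ρ : Matrix (ZMod d) (ZMod d) ℂ) (v : EReal) : Prop :=
  Tendsto (fun n : ℕ => thauma (tensorPow ρ n) / (n : EReal)) atTop (𝓝 v)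

/-- The regularized relative entropy of magic `lim R_M(ρ^{⊗n}) / n` of a one-qudit state exists and
equals `v`. -/
def HasRegRelEntropyMagic (ρ : Matrix (ZMod d) (ZMod d) ℂ) (v : EReal) : Prop :=
  Tendsto (fun n : ℕ => relEntropyMagic (tensorPow ρ n) / (n : EReal)) atTop (𝓝 v)

end Measures

/-! ### The four qutrit states -/

/-- The projector `|ψ⟩⟨ψ|`. -/
def ketProj (ψ : ZMod 3 → ℂ) : Matrix (ZMod 3) (ZMod 3) ℂ := Matrix.vecMulVec ψ (star ψ)

/-- The vector `a|0⟩ + b|1⟩ + c|2⟩`. -/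
def qutritKet (a b c : ℂ) : ZMod 3 → ℂ := fun j => if j = 0 then a else if j = 1 then b else c

/-- `(|1⟩ - |2⟩) / √2`. -/
def ketStrange : ZMod 3 → ℂ := ((Real.sqrt 2 : ℝ) : ℂ)⁻¹ • qutritKet 0 1 (-1)

/-- `(-|0⟩ + 2|1⟩ - |2⟩) / √6`. -/
def ketNorrell : ZMod 3 → ℂ := ((Real.sqrt 6 : ℝ) : ℂ)⁻¹ • qutritKet (-1) 2 (-1)

/-- `((1 + √3)|0⟩ + |1⟩ + |2⟩) / √(2(3 + √3))`, the normalized eigenvector of the qutrit Hadamard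
gate for the eigenvalue `1`. -/
def ketHPlus : ZMod 3 → ℂ :=
  ((Real.sqrt (2 * (3 + Real.sqrt 3)) : ℝ) : ℂ)⁻¹ • qutritKet ((1 + Real.sqrt 3 : ℝ) : ℂ) 1 1

/-- `ξ = e^{2πi/9}`. -/
def xi : ℂ := Complex.exp (2 * Real.pi * Complex.I / 9)

/-- `(ξ|0⟩ + |1⟩ + ξ⁻¹|2⟩) / √3`. -/
def ketT : ZMod 3 → ℂ := ((Real.sqrt 3 : ℝ) : ℂ)⁻¹ • qutritKet xi 1 xi⁻¹

/-- The qutrit Hadamard gate, with entries `ω^{jk} / √3`. -/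
def hadamard3 : Matrix (ZMod 3) (ZMod 3) ℂ :=
  ((Real.sqrt 3 : ℝ) : ℂ)⁻¹ • Matrix.of fun j k => omega 3 ^ (j.val * k.val)

/-- `|H_+⟩` is indeed fixed by the Hadamard gate. -/
lemma hadamard3_mulVec_ketHPlus : hadamard3 *ᵥ ketHPlus = ketHPlus := by
  have h3 : ((Real.sqrt 3 : ℝ) : ℂ) ^ 2 = 3 := by
    rw [← Complex.ofReal_pow, Real.sq_sqrt (by norm_num)]; norm_num
  have h0 : ((Real.sqrt 3 : ℝ) : ℂ) ≠ 0 := by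
    intro h; rw [h] at h3; norm_num at h3
  have hp : IsPrimitiveRoot (omega 3) 3 := by
    simpa [omega] using Complex.isPrimitiveRoot_exp 3 (by norm_num)
  have hs := hp.geom_sum_eq_zero (by norm_num)
  have h1 := hp.pow_eq_one
  simp only [Finset.sum_range_succ, Finset.sum_range_zero, pow_zero, pow_one] at hs
  have huniv : (Finset.univ : Finset (ZMod 3)) = {0, 1, 2} := by decide
  have v1 : (1 : ZMod 3).val = 1 := rfl
  have v2 : (2 : ZMod 3).val = 2 := rfl
  have d01 : (1 : ZMod 3) ≠ 0 := by decide
  have d02 : (2 : ZMod 3) ≠ 0 := by decide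
  have d12 : (2 : ZMod 3) ≠ 1 := by decide
  have key : (Matrix.of fun j k : ZMod 3 => omega 3 ^ (j.val * k.val)) *ᵥ
      qutritKet ((1 + Real.sqrt 3 : ℝ) : ℂ) 1 1 =
      ((Real.sqrt 3 : ℝ) : ℂ) • qutritKet ((1 + Real.sqrt 3 : ℝ) : ℂ) 1 1 := by
    ext i
    have hi : i = 0 ∨ i = 1 ∨ i = 2 := by revert i; decide
    rcases hi with rfl | rfl | rfl <;>
      simp [Matrix.mulVec, dotProduct, huniv, d01, d02, d12, d01.symm, d02.symm, d12.symm,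
        qutritKet, v1, v2]
    · linear_combination -h3
    · linear_combination hs
    · linear_combination hs + omega 3 * h1
  rw [hadamard3, ketHPlus, Matrix.mulVec_smul, Matrix.smul_mulVec, key, inv_smul_smul₀ h0]

end

/-! For each state ψ a single number `a` controls every measure, because the largest overlap of ψ
with an operator of non-positive mana is a convex optimum whose primal and dual solutions are both
stable under tensor powers. These solutions are collected in `IsThaumaWitness`.

Dual side: choose D ≥ 0 such that |tr A_u(ψ+D)| ≤ a at every phase-space point. Since A_u is a
tensor product, (ψ+D)^{⊗n} has expectations at most a^n, and it dominates ψ^{⊗n}. Writing tr(Vσ) =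
∑_u tr(A_u V) W_σ(u) and pairing the sup norm with the Wigner trace norm gives tr(ψ^{⊗n}σ) ≤ a^n for
every σ in 𝒲 (`trace_le`). This bounds D₀ from below; D ≥ D₀ on pure states by concavity of the
logarithm; D_max is bounded by pairing 2^λσ - ψ^{⊗n} ≥ 0 with ψ^{⊗n}.

Primal side: choose R ≥ 0 with Rψ = 0 such that aψ+R has Wigner trace norm at most 1. The norm is
multiplicative, so (aψ+R)^{⊗n} lies in 𝒲; it has ψ^{⊗n} as eigenvector with eigenvalue a^n and
dominates a^n ψ^{⊗n}, so all three divergences take the value -n log₂ a there. The measures are thus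
exactly additive and the regularized limits are limits of eventually constant sequences.

For R_M, STAB ⊆ 𝒲 gives the lower bound: on a pure stabilizer state the Wigner function is a
normalized sum of a character of (ℤ/3)^n, hence non-negative. For the Norrell and Hadamard states
the primal operator is itself a mixture of one-qutrit stabilizer states, so its powers lie in STAB
and give the upper bound. -/

/-! ### Tensor products of one-qudit operators -/

section TensorProd

variable {d n : ℕ}

/-- The tensor product of `n` one-qudit operators. -/
def tensorProd (M : Fin n → Matrix (ZMod d) (ZMod d) ℂ) : QOp d n :=
  Matrix.of fun i j => ∏ k, M k (i k) (j k)

lemma tensorProd_apply (M : Fin n → Matrix (ZMod d) (ZMod d) ℂ) (i j : Fin n → ZMod d) :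
    tensorProd M i j = ∏ k, M k (i k) (j k) := rfl

lemma tensorPow_eq_tensorProd (ρ : Matrix (ZMod d) (ZMod d) ℂ) (n : ℕ) :
    tensorPow ρ n = tensorProd fun _ => ρ := rfl

lemma conjTranspose_tensorProd (M : Fin n → Matrix (ZMod d) (ZMod d) ℂ) :
    (tensorProd M)ᴴ = tensorProd fun k => (M k)ᴴ := by
  ext i j
  simp [tensorProd_apply, conjTranspose_apply]

lemma tensorProd_smul (c : Fin n → ℂ) (M : Fin n → Matrix (ZMod d) (ZMod d) ℂ) :
    (tensorProd fun k => c k • M k) = (∏ k, c k) • tensorProd M := by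
  ext i j
  simp [tensorProd_apply, Finset.prod_mul_distrib]

lemma tensorProd_sum {ι : Type*} [Fintype ι] (M : Fin n → ι → Matrix (ZMod d) (ZMod d) ℂ) :
    (tensorProd fun k => ∑ x, M k x) = ∑ f : Fin n → ι, tensorProd fun k => M k (f k) := by
  ext i j
  simp only [tensorProd_apply, Matrix.sum_apply]
  exact Fintype.prod_sum fun k x => M k x (i k) (j k)

lemma tensorProd_one : tensorProd (fun _ : Fin n => (1 : Matrix (ZMod d) (ZMod d) ℂ)) = 1 := by
  ext i j
  rw [tensorProd_apply]
  by_cases h : i = j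
  · subst h
    rw [Matrix.one_apply_eq]
    exact Finset.prod_eq_one fun k _ => Matrix.one_apply_eq _
  · obtain ⟨k, hk⟩ := Function.ne_iff.mp h
    rw [Matrix.one_apply_ne h]
    exact Finset.prod_eq_zero (Finset.mem_univ k) (Matrix.one_apply_ne hk)

lemma tensorProd_single_zero :
    tensorProd (fun _ : Fin n => (Matrix.single 0 0 1 : Matrix (ZMod d) (ZMod d) ℂ)) =
      projZero d n := by
  ext i j
  rw [tensorProd_apply, projZero]
  by_cases h : (0 : Fin n → ZMod d) = i ∧ 0 = j
  · rw [← h.1, ← h.2, Matrix.single_apply_same]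
    exact Finset.prod_eq_one fun k _ => Matrix.single_apply_same _ _ _
  · rw [Matrix.single_apply, if_neg h]
    rw [not_and_or] at h
    rcases h with h | h <;> obtain ⟨k, hk⟩ := Function.ne_iff.mp h <;>
      exact Finset.prod_eq_zero (Finset.mem_univ k) (by
        rw [Matrix.single_apply, if_neg]; simp_all)

variable [NeZero d]

lemma tensorProd_mul (M N : Fin n → Matrix (ZMod d) (ZMod d) ℂ) :
    tensorProd M * tensorProd N = tensorProd fun k => M k * N k := by
  ext i j
  simp only [tensorProd_apply, Matrix.mul_apply, ← Finset.prod_mul_distrib]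
  exact (Fintype.prod_sum fun k x => M k (i k) x * N k x (j k)).symm

lemma trace_tensorProd (M : Fin n → Matrix (ZMod d) (ZMod d) ℂ) :
    (tensorProd M).trace = ∏ k, (M k).trace := by
  simp only [Matrix.trace, Matrix.diag, tensorProd_apply]
  exact (Fintype.prod_sum fun k x => M k x x).symm

/-- Positive semidefinite matrices are Gram matrices. -/
lemma Matrix.PosSemidef.exists_eq_conjTranspose_mul_self {α : Type*} [Fintype α] [DecidableEq α]
    {M : Matrix α α ℂ} (hM : M.PosSemidef) : ∃ B : Matrix α α ℂ, M = Bᴴ * B := by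
  open scoped MatrixOrder in
  exact CStarAlgebra.nonneg_iff_eq_star_mul_self.mp hM.nonneg

lemma Matrix.PosSemidef.trace_mul_nonneg {α : Type*} [Fintype α] [DecidableEq α]
    {M N : Matrix α α ℂ} (hM : M.PosSemidef) (hN : N.PosSemidef) : 0 ≤ (M * N).trace := by
  obtain ⟨B, rfl⟩ := hM.exists_eq_conjTranspose_mul_self
  rw [Matrix.mul_assoc, Matrix.trace_mul_comm]
  exact (hN.mul_mul_conjTranspose_same B).trace_nonneg

lemma posSemidef_tensorProd {M : Fin n → Matrix (ZMod d) (ZMod d) ℂ}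
    (hM : ∀ k, (M k).PosSemidef) : (tensorProd M).PosSemidef := by
  choose B hB using fun k => (hM k).exists_eq_conjTranspose_mul_self
  have : tensorProd M = (tensorProd B)ᴴ * tensorProd B := by
    rw [conjTranspose_tensorProd, tensorProd_mul]
    simp_rw [← hB]
  rw [this]
  exact Matrix.posSemidef_conjTranspose_mul_self _

/-- Tensor powers are monotone on positive semidefinite operators. -/
lemma posSemidef_tensorPow_add_sub {M D : Matrix (ZMod d) (ZMod d) ℂ} (hM : M.PosSemidef)
    (hD : D.PosSemidef) (n : ℕ) : (tensorPow (M + D) n - tensorPow M n).PosSemidef := by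
  -- Expand the power over the choice of M or D in each factor. The constant choice M is the
  -- subtracted term; every other term is a product of positive operators.
  have h : tensorPow (M + D) n =
      ∑ f : Fin n → Bool, tensorProd fun k => if f k then M else D := by
    rw [tensorPow_eq_tensorProd,
      ← tensorProd_sum fun _ (b : Bool) => if b = true then M else D]
    simp
  rw [h, ← Finset.add_sum_erase _ _ (Finset.mem_univ fun _ => true)]
  simp only [if_true, tensorPow_eq_tensorProd, add_sub_cancel_left]
  refine Matrix.posSemidef_sum _ fun f _ => posSemidef_tensorProd fun k => ?_
  split_ifs
  exacts [hM, hD]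

end TensorProd

/-! ### Explicit Heisenberg-Weyl and phase-space point operators of qutrits -/

section Wigner

open ZMod

/-- The standard additive character of `ℤ/3`. -/
local notation "χ" => (ZMod.stdAddChar : AddChar (ZMod 3) ℂ)

lemma omega_pow_val (j : ZMod 3) : omega 3 ^ j.val = χ j := by
  have h : ((j.val : ℤ) : ZMod 3) = j := by simp
  conv_rhs => rw [← h, ZMod.stdAddChar_coe]
  rw [omega, ← Complex.exp_nat_mul]
  congr 1
  push_cast
  ring

lemma tau_eq_omega_sq : tau 3 = omega 3 ^ 2 := by
  rw [tau, omega, ← Complex.exp_nat_mul]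
  congr 1
  push_cast
  ring

lemma conj_stdAddChar (x : ZMod 3) : star (χ x) = χ (-x) := by
  rw [AddChar.map_neg_eq_conj]; rfl

lemma sum_stdAddChar_mul (b : ZMod 3) : ∑ x, χ (x * b) = if b = 0 then 3 else 0 := by
  rw [AddChar.sum_mulShift b (ZMod.isPrimitive_stdAddChar 3)]
  split_ifs <;> simp

lemma shiftX_pow_apply (m : ℕ) (i j : ZMod 3) :
    (shiftX 3 ^ m) i j = if i = j + m then 1 else 0 := by
  induction m generalizing i j with
  | zero => simp [Matrix.one_apply]
  | succ m ih =>
    rw [pow_succ, Matrix.mul_apply]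
    simp only [ih]
    simp only [shiftX, Matrix.of_apply, mul_ite, mul_one, mul_zero, Finset.sum_ite_eq',
      Finset.mem_univ, if_true]
    congr 1
    push_cast
    rw [add_assoc, add_comm (1 : ZMod 3)]

/-- Since τ = ω² and -2 = 1 in ℤ/3, the prefactor τ^{-a₁a₂} is simply ω^{a₁a₂}. -/
lemma weylOne_apply (u : ZMod 3 × ZMod 3) (i j : ZMod 3) :
    weylOne 3 u i j = if i = j + u.2 then χ (u.1 * (u.2 + i)) else 0 := by
  have h : (tau 3 ^ (u.1.val * u.2.val))⁻¹ = χ (u.1 * u.2) := by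
    rw [tau_eq_omega_sq, ← pow_mul, mul_comm 2, pow_mul, pow_mul, omega_pow_val,
      ← AddChar.map_nsmul_eq_pow, ← AddChar.map_nsmul_eq_pow, ← AddChar.map_neg_eq_inv]
    congr 1
    obtain ⟨a, b⟩ := u
    revert a b
    decide
  have h2 : (boostZ 3 ^ u.1.val) = Matrix.diagonal fun j => χ (u.1 * j) := by
    rw [boostZ, Matrix.diagonal_pow]
    congr 1
    ext j
    rw [Pi.pow_apply, omega_pow_val, ← AddChar.map_nsmul_eq_pow]
    simp
  rw [weylOne, h, h2, Matrix.smul_apply, Matrix.diagonal_mul, shiftX_pow_apply]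
  simp only [ZMod.natCast_val, ZMod.cast_id', id_eq, smul_eq_mul, mul_ite, mul_one, mul_zero]
  rw [mul_add, AddChar.map_add_eq_mul]

lemma weyl_eq_tensorProd {n : ℕ} (u : PhaseSpace 3 n) :
    weyl u = tensorProd fun k => weylOne 3 (u k) := rfl

/-- The one-qutrit phase-space point operators. -/
noncomputable def phasePointOne (u : ZMod 3 × ZMod 3) : Matrix (ZMod 3) (ZMod 3) ℂ :=
  Matrix.of fun i j => if i + j = 2 * u.2 then χ (u.1 * (i - j)) else 0

/-- A_0 is the parity j ↦ -j: the sum over boosts is a character sum that leaves only i + j = 0. -/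
lemma sum_weylOne : (3 : ℂ)⁻¹ • ∑ u, weylOne 3 u = phasePointOne 0 := by
  ext i j
  simp only [Matrix.smul_apply, Matrix.sum_apply, weylOne_apply, phasePointOne, Matrix.of_apply]
  rw [Fintype.sum_prod_type]
  have h : ∀ y, (i = j + y) = (y = i - j) := fun y => by
    rw [eq_iff_iff, eq_sub_iff_add_eq', eq_comm]
  simp only [h, Finset.sum_ite_eq', Finset.mem_univ, if_true]
  rw [sum_stdAddChar_mul]
  have h2 : (i - j + i = 0) = (i + j = 2 * (0 : ZMod 3 × ZMod 3).2) := by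
    revert i j; decide
  simp [h2]

lemma phasePointOne_apply (u : ZMod 3 × ZMod 3) (i j : ZMod 3) :
    phasePointOne u i j = if i + j = 2 * u.2 then χ (u.1 * (i - j)) else 0 := rfl

lemma weylOne_mul_apply (u : ZMod 3 × ZMod 3) (M : Matrix (ZMod 3) (ZMod 3) ℂ) (i j : ZMod 3) :
    (weylOne 3 u * M) i j = χ (u.1 * (u.2 + i)) * M (i - u.2) j := by
  rw [Matrix.mul_apply, Finset.sum_eq_single (i - u.2)]
  · simp [weylOne_apply]
  · intro b _ hb
    rw [weylOne_apply, if_neg fun h => hb (eq_sub_of_add_eq h.symm), zero_mul]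
  · simp

lemma mul_weylOne_conjTranspose_apply (u : ZMod 3 × ZMod 3) (M : Matrix (ZMod 3) (ZMod 3) ℂ)
    (i j : ZMod 3) :
    (M * (weylOne 3 u)ᴴ) i j = M i (j - u.2) * χ (-(u.1 * (u.2 + j))) := by
  rw [Matrix.mul_apply, Finset.sum_eq_single (j - u.2)]
  · simp [weylOne_apply, Matrix.conjTranspose_apply, ← conj_stdAddChar]
  · intro b _ hb
    rw [Matrix.conjTranspose_apply, weylOne_apply, if_neg fun h => hb (eq_sub_of_add_eq h.symm),
      star_zero, mul_zero]
  · simp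

lemma weylOne_conj_phasePointOne_zero (u : ZMod 3 × ZMod 3) :
    weylOne 3 u * phasePointOne 0 * (weylOne 3 u)ᴴ = phasePointOne u := by
  ext i j
  rw [mul_weylOne_conjTranspose_apply, weylOne_mul_apply, phasePointOne_apply, phasePointOne_apply]
  have h1 : (i - u.2 + (j - u.2) = 2 * (0 : ZMod 3 × ZMod 3).2) = (i + j = 2 * u.2) := by
    rw [Prod.snd_zero]
    generalize u.2 = b
    revert i j b
    decide
  simp only [h1, Prod.fst_zero, zero_mul, AddChar.map_zero_eq_one, mul_ite, mul_one, mul_zero,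
    ite_mul, ← AddChar.map_add_eq_mul]
  congr 2
  ring

lemma phasePoint_eq_tensorProd {n : ℕ} (u : PhaseSpace 3 n) :
    phasePoint u = tensorProd fun k => phasePointOne (u k) := by
  have h : phasePointZero 3 n = tensorProd fun _ => phasePointOne 0 := by
    simp_rw [← sum_weylOne]
    rw [tensorProd_smul, tensorProd_sum, phasePointZero]
    simp [weyl_eq_tensorProd]
  rw [phasePoint, h, weyl_eq_tensorProd, conjTranspose_tensorProd, tensorProd_mul, tensorProd_mul]
  simp_rw [weylOne_conj_phasePointOne_zero]

/-- Completeness, ∑_u A_u ⊗ A_u = 3·SWAP: the position coordinate forces i + j = k + l, and the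
character sum over the other coordinate forces i - j + k - l = 0. -/
lemma sum_phasePointOne_mul (i j k l : ZMod 3) :
    ∑ u, phasePointOne u i j * phasePointOne u k l = if i = l ∧ j = k then 3 else 0 := by
  simp only [phasePointOne, Matrix.of_apply]
  rw [Fintype.sum_prod_type_right]
  have h : ∀ y x : ZMod 3, ((if i + j = 2 * y then χ (x * (i - j)) else 0) *
      (if k + l = 2 * y then χ (x * (k - l)) else 0)) =
      if y = 2 * (i + j) then (if k + l = i + j then χ (x * (i - j + (k - l))) else 0) else 0 := by
    intro y x
    -- 2 is its own inverse in ℤ/3, so the reflection centre y is determined by i + j.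
    have h1 : (i + j = 2 * y) = (y = 2 * (i + j)) := by revert i j y; decide
    by_cases hy : y = 2 * (i + j)
    · rw [if_pos (h1.symm ▸ hy), if_pos hy, ← (h1.symm ▸ hy : i + j = 2 * y)]
      rw [mul_ite, mul_zero, mul_add, AddChar.map_add_eq_mul]
    · rw [if_neg (h1.symm ▸ hy), if_neg hy, zero_mul]
  simp only [h]
  rw [Finset.sum_comm]
  simp only [Finset.sum_ite_eq', Finset.mem_univ, if_true]
  clear h
  have h2 : (i = l ∧ j = k) = (k + l = i + j ∧ i - j + (k - l) = 0) := by
    revert i j k l; decide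
  simp only [h2, ite_and]
  split_ifs with h3 h4
  · rw [sum_stdAddChar_mul, if_pos h4]
  · rw [sum_stdAddChar_mul, if_neg h4]
  · simp

lemma sum_phasePoint_mul {n : ℕ} (i j k l : Fin n → ZMod 3) :
    ∑ u : PhaseSpace 3 n, phasePoint u i j * phasePoint u k l =
      if i = l ∧ j = k then 3 ^ n else 0 := by
  simp only [phasePoint_eq_tensorProd, tensorProd_apply, ← Finset.prod_mul_distrib]
  rw [← Fintype.prod_sum fun m x => phasePointOne x (i m) (j m) * phasePointOne x (k m) (l m)]
  simp only [sum_phasePointOne_mul]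
  split_ifs with h
  · simp [h.1, h.2]
  · have : ∃ m, ¬ (i m = l m ∧ j m = k m) := by
      by_contra hc
      push Not at hc
      exact h ⟨funext fun m => (hc m).1, funext fun m => (hc m).2⟩
    obtain ⟨m, hm⟩ := this
    exact Finset.prod_eq_zero (Finset.mem_univ m) (if_neg hm)

/-- The Hilbert-Schmidt product in terms of expectations of phase-space point operators. -/
lemma trace_mul_eq_sum_phasePoint {n : ℕ} (V σ : QOp 3 n) :
    (V * σ).trace = ∑ u, (phasePoint u * V).trace * wigner σ u := by
  have h3 : (3 : ℂ) ^ n ≠ 0 := by positivity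
  have key : ∑ u, (phasePoint u * V).trace * (phasePoint u * σ).trace =
      (3 : ℂ) ^ n * (V * σ).trace := by
    simp only [Matrix.trace, Matrix.diag, Matrix.mul_apply, Finset.sum_mul_sum]
    calc _ = ∑ i, ∑ k, ∑ j, ∑ l, (∑ u : PhaseSpace 3 n, phasePoint u i j * phasePoint u k l) *
          (V j i * σ l k) := by
          rw [Finset.sum_comm]
          refine Finset.sum_congr rfl fun i _ => ?_
          rw [Finset.sum_comm]
          refine Finset.sum_congr rfl fun k _ => ?_
          rw [Finset.sum_comm]
          refine Finset.sum_congr rfl fun j _ => ?_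
          rw [Finset.sum_comm]
          refine Finset.sum_congr rfl fun l _ => ?_
          rw [Finset.sum_mul]
          refine Finset.sum_congr rfl fun u _ => ?_
          ring
      _ = _ := by
          simp only [sum_phasePoint_mul, ite_and, ite_mul, zero_mul]
          simp only [Finset.sum_ite_eq, Finset.sum_ite_eq',
            Finset.mem_univ, if_true, Finset.mul_sum]
          rw [Finset.sum_comm]
  calc _ = ((3 : ℂ) ^ n)⁻¹ * ∑ u, (phasePoint u * V).trace * (phasePoint u * σ).trace := by
        rw [key, inv_mul_cancel_left₀ h3]
    _ = _ := by
        rw [Finset.mul_sum]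
        refine Finset.sum_congr rfl fun u _ => ?_
        rw [wigner]
        push_cast
        field_simp

lemma trace_phasePoint_mul_tensorProd {n : ℕ} (u : PhaseSpace 3 n)
    (M : Fin n → Matrix (ZMod 3) (ZMod 3) ℂ) :
    (phasePoint u * tensorProd M).trace = ∏ k, (phasePointOne (u k) * M k).trace := by
  rw [phasePoint_eq_tensorProd, tensorProd_mul, trace_tensorProd]

lemma trace_phasePointOne (u : ZMod 3 × ZMod 3) : (phasePointOne u).trace = 1 := by
  have h : ∀ i, (i + i = 2 * u.2) = (i = u.2) := by
    generalize u.2 = b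
    revert b
    decide
  simp [Matrix.trace, phasePointOne, h]

lemma sum_wigner {n : ℕ} (σ : QOp 3 n) : ∑ u, wigner σ u = σ.trace := by
  have h := trace_mul_eq_sum_phasePoint 1 σ
  rw [one_mul] at h
  rw [h]
  refine Finset.sum_congr rfl fun u _ => ?_
  rw [← tensorProd_one, trace_phasePoint_mul_tensorProd]
  simp [trace_phasePointOne]

/-- Hölder's inequality on phase space: the sup of the expectations of V is dual to the Wigner trace
norm of σ. -/
lemma norm_trace_mul_le {n : ℕ} {V σ : QOp 3 n} {a : ℝ}
    (hV : ∀ u, ‖(phasePoint u * V).trace‖ ≤ a) : ‖(V * σ).trace‖ ≤ a * wignerTraceNorm σ := by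
  rw [trace_mul_eq_sum_phasePoint, wignerTraceNorm, Finset.mul_sum]
  refine (norm_sum_le _ _).trans (Finset.sum_le_sum fun u _ => ?_)
  rw [norm_mul]
  exact mul_le_mul_of_nonneg_right (hV u) (norm_nonneg _)

lemma wignerTraceNorm_tensorPow (ρ : Matrix (ZMod 3) (ZMod 3) ℂ) (n : ℕ) :
    wignerTraceNorm (tensorPow ρ n) = (∑ u, ‖(phasePointOne u * ρ).trace‖ / 3) ^ n := by
  simp only [wignerTraceNorm, wigner, tensorPow_eq_tensorProd, trace_phasePoint_mul_tensorProd]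
  have h : ∀ u : PhaseSpace 3 n, ‖(∏ k, (phasePointOne (u k) * ρ).trace) / ((3 : ℕ) : ℂ) ^ n‖ =
      ∏ k, (‖(phasePointOne (u k) * ρ).trace‖ / 3) := by
    intro u
    simp [Finset.prod_div_distrib]
  simp only [h]
  rw [← Fintype.prod_sum fun (_ : Fin n) x => ‖(phasePointOne x * ρ).trace‖ / 3]
  simp

/-! ### Operators of non-positive mana -/

lemma mana_nonpos_iff {d n : ℕ} [NeZero d] (σ : QOp d n) : mana σ ≤ 0 ↔ wignerTraceNorm σ ≤ 1 := by
  have h0 : 0 ≤ wignerTraceNorm σ := Finset.sum_nonneg fun _ _ => norm_nonneg _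
  rw [mana]
  split_ifs with h
  · simp [h]
  · rw [show (0 : EReal) = ((0 : ℝ) : EReal) from rfl, EReal.coe_le_coe_iff,
      Real.logb_nonpos_iff (by norm_num) (lt_of_le_of_ne h0 (Ne.symm h))]

/-- By the triangle inequality for the Wigner trace norm. It reduces STAB ⊆ 𝒲 to pure stabilizer
states. -/
lemma convex_nonposMana {d n : ℕ} [NeZero d] : Convex ℝ (nonposMana d n) := by
  intro x hx y hy a b ha hb hab
  refine ⟨(mana_nonpos_iff _).mpr ?_, ?_⟩
  · have h : wignerTraceNorm (a • x + b • y) ≤ a * wignerTraceNorm x + b * wignerTraceNorm y := by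
      simp only [wignerTraceNorm, Finset.mul_sum]
      rw [← Finset.sum_add_distrib]
      refine Finset.sum_le_sum fun u _ => ?_
      have : wigner (a • x + b • y) u = a * wigner x u + b * wigner y u := by
        simp only [wigner, Matrix.mul_add, Matrix.mul_smul, Matrix.trace_add, Matrix.trace_smul,
          Complex.real_smul]
        ring
      rw [this]
      refine (norm_add_le _ _).trans ?_
      simp [abs_of_nonneg ha, abs_of_nonneg hb]
    have hx1 := (mana_nonpos_iff _).mp hx.1
    have hy1 := (mana_nonpos_iff _).mp hy.1
    calc _ ≤ a * wignerTraceNorm x + b * wignerTraceNorm y := h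
      _ ≤ a * 1 + b * 1 := by gcongr
      _ = 1 := by linarith
  · exact (hx.2.smul ha).add (hy.2.smul hb)

end Wigner

/-! ### Divergences of pure states -/

section PureStates

variable {α : Type*} [Fintype α]

lemma trace_vecMulVec_mul (v w : α → ℂ) (M : Matrix α α ℂ) :
    (vecMulVec v w * M).trace = w ⬝ᵥ M *ᵥ v := by
  rw [Matrix.vecMulVec_mul, Matrix.trace_vecMulVec, dotProduct_comm, ← Matrix.dotProduct_mulVec]

lemma isHermitian_vecMulVec_star (v : α → ℂ) : (vecMulVec v (star v)).IsHermitian :=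
  (posSemidef_vecMulVec_self_star v).isHermitian

lemma isIdempotentElem_vecMulVec_star {v : α → ℂ} (hv : star v ⬝ᵥ v = 1) :
    IsIdempotentElem (vecMulVec v (star v)) := by
  rw [IsIdempotentElem, Matrix.vecMulVec_mul_vecMulVec, hv, one_smul]

variable [DecidableEq α]

/-- The amplitudes of `v` in an eigenbasis of `σ`. -/
noncomputable def eigenAmplitude {σ : Matrix α α ℂ} (hσ : σ.IsHermitian) (v : α → ℂ) : α → ℂ :=
  (hσ.eigenvectorUnitary : Matrix α α ℂ)ᴴ *ᵥ v

/-- The squared amplitudes are the spectral distribution of σ in the state v, so divergences of pure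
states become averages over eigenvalues. -/
lemma trace_vecMulVec_mul_cfc {σ : Matrix α α ℂ} (hσ : σ.IsHermitian) (v : α → ℂ) (f : ℝ → ℝ) :
    (vecMulVec v (star v) * cfc f σ).trace =
      ((∑ i, ‖eigenAmplitude hσ v i‖ ^ 2 * f (hσ.eigenvalues i) : ℝ) : ℂ) := by
  rw [trace_vecMulVec_mul, hσ.cfc_eq, Matrix.IsHermitian.cfc, Unitary.conjStarAlgAut_apply,
    Matrix.star_eq_conjTranspose, ← Matrix.mulVec_mulVec, ← Matrix.mulVec_mulVec,
    Matrix.dotProduct_mulVec,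
    ← Matrix.conjTranspose_conjTranspose (hσ.eigenvectorUnitary : Matrix α α ℂ), ← Matrix.star_mulVec, Matrix.conjTranspose_conjTranspose]
  change star (eigenAmplitude hσ v) ⬝ᵥ _ *ᵥ eigenAmplitude hσ v = _
  rw [dotProduct]
  push_cast
  refine Finset.sum_congr rfl fun i _ => ?_
  rw [Matrix.mulVec_diagonal, Pi.star_apply, ← Complex.conj_mul']
  simp only [Function.comp_apply, RCLike.star_def, Complex.coe_algebraMap]
  ring

lemma sum_sq_eigenAmplitude {σ : Matrix α α ℂ} (hσ : σ.IsHermitian) (v : α → ℂ)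
    (hv : star v ⬝ᵥ v = 1) : ∑ i, ‖eigenAmplitude hσ v i‖ ^ 2 = 1 := by
  have h := trace_vecMulVec_mul_cfc hσ v fun _ => 1
  rw [cfc_const_one ℝ σ hσ.isSelfAdjoint, trace_vecMulVec_mul, Matrix.one_mulVec, hv] at h
  simp only [mul_one] at h
  exact_mod_cast h.symm

lemma sum_sq_eigenAmplitude_mul {σ : Matrix α α ℂ} (hσ : σ.IsHermitian) (v : α → ℂ) :
    ((∑ i, ‖eigenAmplitude hσ v i‖ ^ 2 * hσ.eigenvalues i : ℝ) : ℂ) =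
      (vecMulVec v (star v) * σ).trace := by
  have h := trace_vecMulVec_mul_cfc hσ v fun x => x
  rw [cfc_id' ℝ σ hσ.isSelfAdjoint] at h
  exact h.symm

lemma eigenAmplitude_of_mulVec_eq_smul {σ : Matrix α α ℂ} (hσ : σ.IsHermitian) {v : α → ℂ} {c : ℝ}
    (hv : σ *ᵥ v = (c : ℂ) • v) (i : α) :
    eigenAmplitude hσ v i = 0 ∨ hσ.eigenvalues i = c := by
  have h : (hσ.eigenvectorUnitary : Matrix α α ℂ)ᴴ * σ =
      diagonal (RCLike.ofReal ∘ hσ.eigenvalues) * (hσ.eigenvectorUnitary : Matrix α α ℂ)ᴴ := by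
    refine (congrArg _ hσ.spectral_theorem).trans ?_
    rw [Unitary.conjStarAlgAut_apply, ← Matrix.star_eq_conjTranspose, ← Matrix.mul_assoc,
      ← Matrix.mul_assoc, Unitary.coe_star_mul_self, Matrix.one_mul]
  have h2 := congrFun (congrArg (· *ᵥ v) h) i
  simp only [← Matrix.mulVec_mulVec, hv, Matrix.mulVec_smul, Pi.smul_apply,
    Matrix.mulVec_diagonal] at h2
  change (c : ℂ) * eigenAmplitude hσ v i = ((hσ.eigenvalues i : ℝ) : ℂ) * eigenAmplitude hσ v i at h2
  by_cases h0 : eigenAmplitude hσ v i = 0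
  · exact Or.inl h0
  · exact Or.inr (by exact_mod_cast (mul_right_cancel₀ h0 h2).symm)

/-- An eigenvector of eigenvalue 0 is killed by |v⟩⟨v|, hence orthogonal to v. The conventional
value `Real.logb 2 0 = 0` therefore carries no weight. -/
lemma eigenAmplitude_eq_zero_of_ker_le {σ : Matrix α α ℂ} (hσ : σ.IsHermitian) {v : α → ℂ}
    (hker : ∀ w : α → ℂ, σ *ᵥ w = 0 → vecMulVec v (star v) *ᵥ w = 0) {i : α}
    (hi : hσ.eigenvalues i = 0) : eigenAmplitude hσ v i = 0 := by
  set w : α → ℂ := (hσ.eigenvectorBasis i).ofLp with hw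
  have h1 : σ *ᵥ w = 0 := by rw [hσ.mulVec_eigenvectorBasis, hi, zero_smul]
  have h2 := hker w h1
  have hx : eigenAmplitude hσ v i = star (star v ⬝ᵥ w) := by
    rw [← Matrix.star_dotProduct, eigenAmplitude]
    rfl
  have h3 : ∀ j, v j * (star v ⬝ᵥ w) = 0 := fun j => by
    have := congrFun h2 j
    rwa [Matrix.vecMulVec_mulVec] at this
  rw [hx]
  by_cases h0 : star v ⬝ᵥ w = 0
  · rw [h0, star_zero]
  · have hv : v = 0 := funext fun j => (mul_eq_zero.mp (h3 j)).resolve_right h0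
    simp [hv]

lemma spectrum_vecMulVec_star_subset {v : α → ℂ} (hv : star v ⬝ᵥ v = 1) :
    spectrum ℝ (vecMulVec v (star v)) ⊆ {0, 1} :=
  (isIdempotentElem_vecMulVec_star hv).spectrum_subset ℝ

lemma supportProj_vecMulVec_star {v : α → ℂ} (hv : star v ⬝ᵥ v = 1) :
    supportProj (vecMulVec v (star v)) = vecMulVec v (star v) := by
  rw [supportProj]
  conv_rhs => rw [← cfc_id' ℝ (vecMulVec v (star v)) (isHermitian_vecMulVec_star v).isSelfAdjoint]
  refine cfc_congr fun x hx => ?_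
  rcases spectrum_vecMulVec_star_subset hv hx with rfl | rfl <;> simp

/-- `Real.logb 2` vanishes at both possible spectral values 0 and 1; at 0 this is its default value.
-/
lemma cfc_logb_vecMulVec_star {v : α → ℂ} (hv : star v ⬝ᵥ v = 1) :
    cfc (Real.logb 2) (vecMulVec v (star v)) = 0 := by
  rw [← cfc_const_zero ℝ (vecMulVec v (star v))]
  refine cfc_congr fun x hx => ?_
  rcases spectrum_vecMulVec_star_subset hv hx with rfl | rfl <;> simp

lemma relEntropyZero_vecMulVec_star {v : α → ℂ} (hv : star v ⬝ᵥ v = 1) (σ : Matrix α α ℂ) :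
    relEntropyZero (vecMulVec v (star v)) σ =
      if (vecMulVec v (star v) * σ).trace.re = 0 then ⊤
      else ((-Real.logb 2 (vecMulVec v (star v) * σ).trace.re : ℝ) : EReal) := by
  rw [relEntropyZero, supportProj_vecMulVec_star hv]

lemma trace_mul_cfc_sub_cfc_vecMulVec_star {σ : Matrix α α ℂ} (hσ : σ.IsHermitian) {v : α → ℂ}
    (hv : star v ⬝ᵥ v = 1) :
    (vecMulVec v (star v) * (cfc (Real.logb 2) (vecMulVec v (star v)) -
      cfc (Real.logb 2) σ)).trace.re =
      -∑ i, ‖eigenAmplitude hσ v i‖ ^ 2 * Real.logb 2 (hσ.eigenvalues i) := by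
  rw [cfc_logb_vecMulVec_star hv, zero_sub, Matrix.mul_neg, Matrix.trace_neg,
    trace_vecMulVec_mul_cfc hσ, Complex.neg_re, Complex.ofReal_re]

/-- The relative entropy dominates the one of order zero on pure states. -/
lemma relEntropyZero_le_relEntropy {σ : Matrix α α ℂ} (hσ : σ.PosSemidef) {v : α → ℂ}
    (hv : star v ⬝ᵥ v = 1) :
    relEntropyZero (vecMulVec v (star v)) σ ≤ relEntropy (vecMulVec v (star v)) σ := by
  rw [relEntropyZero_vecMulVec_star hv, relEntropy]
  split_ifs with h0 hker hker
  -- Zero overlap kills all amplitudes at positive eigenvalues, and the support condition kills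
  -- those at 0, contradicting norm one.
  · exfalso
    have h := congrArg Complex.re (sum_sq_eigenAmplitude_mul hσ.isHermitian v)
    rw [h0, Complex.ofReal_re, Finset.sum_eq_zero_iff_of_nonneg fun i _ =>
      mul_nonneg (sq_nonneg _) (hσ.eigenvalues_nonneg i)] at h
    have h1 := sum_sq_eigenAmplitude hσ.isHermitian v hv
    rw [Finset.sum_eq_zero fun i _ => ?_] at h1
    · exact zero_ne_one h1
    · rcases mul_eq_zero.mp (h i (Finset.mem_univ i)) with h2 | h2
      · exact h2
      · rw [eigenAmplitude_eq_zero_of_ker_le hσ.isHermitian hker h2]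
        simp
  · exact le_rfl
  · rw [trace_mul_cfc_sub_cfc_vecMulVec_star hσ.isHermitian hv, EReal.coe_le_coe_iff, neg_le_neg_iff]
    have h := congrArg Complex.re (sum_sq_eigenAmplitude_mul hσ.isHermitian v)
    rw [Complex.ofReal_re] at h
    rw [← h] at h0 ⊢
    have hc : 0 < ∑ i, ‖eigenAmplitude hσ.isHermitian v i‖ ^ 2 * hσ.isHermitian.eigenvalues i :=
      lt_of_le_of_ne (Finset.sum_nonneg fun i _ =>
        mul_nonneg (sq_nonneg _) (hσ.eigenvalues_nonneg i)) (Ne.symm h0)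
    set c := ∑ i, ‖eigenAmplitude hσ.isHermitian v i‖ ^ 2 * hσ.isHermitian.eigenvalues i with hcdef
    have h2 : 0 < Real.log 2 := Real.log_pos (by norm_num)
    -- Jensen by the tangent line of the logarithm at the mean c: log λ ≤ log c + λ/c - 1. Averaging
    -- cancels the linear part.
    have hterm : ∀ i, ‖eigenAmplitude hσ.isHermitian v i‖ ^ 2 *
        Real.logb 2 (hσ.isHermitian.eigenvalues i) ≤
        ‖eigenAmplitude hσ.isHermitian v i‖ ^ 2 * (Real.logb 2 c - 1 / Real.log 2) +
        ‖eigenAmplitude hσ.isHermitian v i‖ ^ 2 * hσ.isHermitian.eigenvalues i *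
          (1 / (c * Real.log 2)) := by
      intro i
      rcases (hσ.eigenvalues_nonneg i).eq_or_lt with hi | hi
      · rw [eigenAmplitude_eq_zero_of_ker_le hσ.isHermitian hker hi.symm]
        simp
      · rw [mul_assoc, ← mul_add]
        refine mul_le_mul_of_nonneg_left ?_ (sq_nonneg _)
        have h3 := Real.log_le_sub_one_of_pos (div_pos hi hc)
        rw [Real.log_div hi.ne' hc.ne'] at h3
        have h4 : Real.logb 2 c - 1 / Real.log 2 +
            hσ.isHermitian.eigenvalues i * (1 / (c * Real.log 2)) =
            (Real.log c + (hσ.isHermitian.eigenvalues i / c - 1)) / Real.log 2 := by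
          rw [Real.logb]
          field_simp
          ring
        rw [h4, Real.logb]
        gcongr
        linarith
    refine (Finset.sum_le_sum fun i _ => hterm i).trans ?_
    rw [Finset.sum_add_distrib, ← Finset.sum_mul, ← Finset.sum_mul, ← hcdef,
      sum_sq_eigenAmplitude hσ.isHermitian v hv]
    apply le_of_eq
    field_simp
    ring
  · exact le_top

/-- The relative entropy of a pure state with respect to an operator of which it is an
eigenvector. -/
lemma relEntropy_of_mulVec_eq_smul {σ : Matrix α α ℂ} (hσ : σ.IsHermitian) {v : α → ℂ}
    (hv : star v ⬝ᵥ v = 1) {c : ℝ} (hc : 0 < c) (h : σ *ᵥ v = (c : ℂ) • v) :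
    relEntropy (vecMulVec v (star v)) σ = ((-Real.logb 2 c : ℝ) : EReal) := by
  rw [relEntropy, if_pos, trace_mul_cfc_sub_cfc_vecMulVec_star hσ hv]
  · have h1 : ∀ i, ‖eigenAmplitude hσ v i‖ ^ 2 * Real.logb 2 (hσ.eigenvalues i) =
        ‖eigenAmplitude hσ v i‖ ^ 2 * Real.logb 2 c := by
      intro i
      rcases eigenAmplitude_of_mulVec_eq_smul hσ h i with h0 | h0 <;> simp [h0]
    simp only [h1]
    rw [← Finset.sum_mul, sum_sq_eigenAmplitude hσ v hv, one_mul]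
  -- The support condition: ⟨v, σw⟩ = c⟨v, w⟩, so w in the kernel of σ is orthogonal to v.
  · intro w hw
    have h2 : star v ⬝ᵥ σ *ᵥ w = (c : ℂ) * (star v ⬝ᵥ w) := by
      have h3 : star v ᵥ* σ = star ((c : ℂ) • v) := by
        rw [← h, Matrix.star_mulVec, hσ.eq]
      rw [Matrix.dotProduct_mulVec, h3]
      simp
    rw [hw, dotProduct_zero] at h2
    have h4 : star v ⬝ᵥ w = 0 :=
      (mul_eq_zero.mp h2.symm).resolve_left (by exact_mod_cast hc.ne')
    rw [Matrix.vecMulVec_mulVec, h4]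
    simp

end PureStates

/-! ### Thauma of tensor powers of a pure state from matching primal and dual witnesses -/

section Witness

/-- The tensor power of a one-qutrit vector. -/
def ketPow (e : ZMod 3 → ℂ) (n : ℕ) : (Fin n → ZMod 3) → ℂ := fun i => ∏ k, e (i k)

lemma tensorPow_ketProj (e : ZMod 3 → ℂ) (n : ℕ) :
    tensorPow (ketProj e) n = vecMulVec (ketPow e n) (star (ketPow e n)) := by
  ext i j
  simp [tensorPow, ketProj, ketPow, vecMulVec_apply, Finset.prod_mul_distrib]

lemma star_ketPow_dotProduct (e : ZMod 3 → ℂ) (n : ℕ) :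
    star (ketPow e n) ⬝ᵥ ketPow e n = (star e ⬝ᵥ e) ^ n := by
  simp only [dotProduct, ketPow, Pi.star_apply, star_prod, ← Finset.prod_mul_distrib]
  rw [← Fintype.prod_sum fun (_ : Fin n) x => star (e x) * e x]
  simp

lemma tensorPow_mulVec_ketPow (σ : Matrix (ZMod 3) (ZMod 3) ℂ) (e : ZMod 3 → ℂ) (n : ℕ) :
    tensorPow σ n *ᵥ ketPow e n = ketPow (σ *ᵥ e) n := by
  ext i
  simp only [Matrix.mulVec, dotProduct, tensorPow_eq_tensorProd, tensorProd_apply, ketPow,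
    ← Finset.prod_mul_distrib]
  exact (Fintype.prod_sum fun k x => σ (i k) x * e x).symm

lemma ketPow_smul (c : ℂ) (e : ZMod 3 → ℂ) (n : ℕ) : ketPow (c • e) n = c ^ n • ketPow e n := by
  ext i
  simp [ketPow, Finset.prod_mul_distrib]

lemma tensorPow_smul (c : ℂ) (M : Matrix (ZMod 3) (ZMod 3) ℂ) (n : ℕ) :
    tensorPow (c • M) n = c ^ n • tensorPow M n := by
  rw [tensorPow_eq_tensorProd, tensorProd_smul, tensorPow_eq_tensorProd]
  simp

lemma posSemidef_ketProj (e : ZMod 3 → ℂ) : (ketProj e).PosSemidef :=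
  posSemidef_vecMulVec_self_star e

/-- A unit vector `e` with an operator `D` such that the phase-space point operators have
expectation at most `a` in `ketProj e + D`, and an operator `R` orthogonal to `e` such that
`a • ketProj e + R` has non-positive mana: optimal witnesses for the overlap `a`. -/
structure IsThaumaWitness (e : ZMod 3 → ℂ) (a : ℝ) (D R : Matrix (ZMod 3) (ZMod 3) ℂ) : Prop where
  unit : star e ⬝ᵥ e = 1
  pos : 0 < a
  posD : D.PosSemidef
  bound : ∀ u, ‖(phasePointOne u * (ketProj e + D)).trace‖ ≤ a
  posR : R.PosSemidef
  orth : R *ᵥ e = 0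
  norm_le : ∑ u, ‖(phasePointOne u * ((a : ℂ) • ketProj e + R)).trace‖ ≤ 3

namespace IsThaumaWitness

variable {e : ZMod 3 → ℂ} {a : ℝ} {D R : Matrix (ZMod 3) (ZMod 3) ℂ}

lemma unit_pow (h : IsThaumaWitness e a D R) (n : ℕ) :
    star (ketPow e n) ⬝ᵥ ketPow e n = 1 := by
  rw [star_ketPow_dotProduct, h.unit, one_pow]

lemma mulVec (h : IsThaumaWitness e a D R) : ((a : ℂ) • ketProj e + R) *ᵥ e = (a : ℂ) • e := by
  rw [Matrix.add_mulVec, h.orth, add_zero, Matrix.smul_mulVec, ketProj, Matrix.vecMulVec_mulVec,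
    h.unit]
  simp

lemma mulVec_pow (h : IsThaumaWitness e a D R) (n : ℕ) :
    tensorPow ((a : ℂ) • ketProj e + R) n *ᵥ ketPow e n = ((a ^ n : ℝ) : ℂ) • ketPow e n := by
  rw [tensorPow_mulVec_ketPow, h.mulVec, ketPow_smul]
  simp

lemma posSemidef_smul (h : IsThaumaWitness e a D R) : ((a : ℂ) • ketProj e).PosSemidef :=
  (posSemidef_ketProj e).smul (by exact_mod_cast h.pos.le)

lemma mem_nonposMana (h : IsThaumaWitness e a D R) (n : ℕ) :
    tensorPow ((a : ℂ) • ketProj e + R) n ∈ nonposMana 3 n := by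
  refine ⟨(mana_nonpos_iff _).mpr ?_,
    posSemidef_tensorProd fun _ => h.posSemidef_smul.add h.posR⟩
  rw [wignerTraceNorm_tensorPow, ← Finset.sum_div]
  refine pow_le_one₀ (by positivity) ?_
  rw [div_le_one (by norm_num)]
  exact h.norm_le

/-- The overlap of `e^{⊗n}` with an operator of non-positive mana is at most `a ^ n`. -/
lemma trace_le (h : IsThaumaWitness e a D R) {n : ℕ} {σ : QOp 3 n} (hσ : σ ∈ nonposMana 3 n) :
    (tensorPow (ketProj e) n * σ).trace.re ≤ a ^ n := by
  -- Replacing ψ by ψ+D only increases the overlap with σ ≥ 0.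
  have h1 := (posSemidef_tensorPow_add_sub (posSemidef_ketProj e) h.posD n).trace_mul_nonneg hσ.2
  rw [Matrix.sub_mul, Matrix.trace_sub, sub_nonneg] at h1
  have h2 : ∀ u : PhaseSpace 3 n, ‖(phasePoint u * tensorPow (ketProj e + D) n).trace‖ ≤ a ^ n := by
    intro u
    rw [tensorPow_eq_tensorProd, trace_phasePoint_mul_tensorProd, norm_prod]
    refine (Finset.prod_le_prod (fun _ _ => norm_nonneg _) fun k _ => h.bound (u k)).trans ?_
    simp
  calc _ ≤ (tensorPow (ketProj e + D) n * σ).trace.re := (Complex.le_def.mp h1).1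
    _ ≤ ‖(tensorPow (ketProj e + D) n * σ).trace‖ := Complex.re_le_norm _
    _ ≤ a ^ n * wignerTraceNorm σ := norm_trace_mul_le h2
    _ ≤ a ^ n * 1 := by
      have := h.pos
      gcongr
      exact (mana_nonpos_iff _).mp hσ.1
    _ = a ^ n := mul_one _

lemma le_relEntropyZero (h : IsThaumaWitness e a D R) {n : ℕ} {σ : QOp 3 n}
    (hσ : σ ∈ nonposMana 3 n) :
    ((-Real.logb 2 (a ^ n) : ℝ) : EReal) ≤ relEntropyZero (tensorPow (ketProj e) n) σ := by
  have h1 := h.trace_le hσ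
  have h2 := (Complex.le_def.mp ((posSemidef_tensorProd (n := n) fun _ =>
    posSemidef_ketProj e).trace_mul_nonneg hσ.2)).1
  rw [← tensorPow_eq_tensorProd, Complex.zero_re] at h2
  rw [tensorPow_ketProj] at h1 h2 ⊢
  rw [relEntropyZero_vecMulVec_star (h.unit_pow n)]
  split_ifs with h0
  · exact le_top
  · rw [EReal.coe_le_coe_iff, neg_le_neg_iff]
    exact Real.logb_le_logb_of_le (by norm_num) (lt_of_le_of_ne h2 (Ne.symm h0)) h1

lemma le_relEntropy (h : IsThaumaWitness e a D R) {n : ℕ} {σ : QOp 3 n}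
    (hσ : σ ∈ nonposMana 3 n) :
    ((-Real.logb 2 (a ^ n) : ℝ) : EReal) ≤ relEntropy (tensorPow (ketProj e) n) σ := by
  refine (h.le_relEntropyZero hσ).trans ?_
  rw [tensorPow_ketProj]
  exact relEntropyZero_le_relEntropy hσ.2 (h.unit_pow n)

lemma trace_tensorPow_mul (h : IsThaumaWitness e a D R) (n : ℕ) :
    (tensorPow (ketProj e) n * tensorPow ((a : ℂ) • ketProj e + R) n).trace =
      ((a ^ n : ℝ) : ℂ) := by
  rw [tensorPow_ketProj, trace_vecMulVec_mul, h.mulVec_pow, dotProduct_smul, h.unit_pow]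
  simp

lemma relEntropy_eq (h : IsThaumaWitness e a D R) (n : ℕ) :
    relEntropy (tensorPow (ketProj e) n) (tensorPow ((a : ℂ) • ketProj e + R) n) =
      ((-Real.logb 2 (a ^ n) : ℝ) : EReal) := by
  rw [tensorPow_ketProj]
  exact relEntropy_of_mulVec_eq_smul (h.mem_nonposMana n).2.isHermitian (h.unit_pow n)
    (pow_pos h.pos n) (h.mulVec_pow n)

lemma thaumaMin_eq (h : IsThaumaWitness e a D R) (n : ℕ) :
    thaumaMin (tensorPow (ketProj e) n) = ((-Real.logb 2 (a ^ n) : ℝ) : EReal) := by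
  refine le_antisymm ((iInf₂_le _ (h.mem_nonposMana n)).trans ?_)
    (le_iInf₂ fun σ hσ => h.le_relEntropyZero hσ)
  have h1 := h.trace_tensorPow_mul n
  rw [tensorPow_ketProj] at h1 ⊢
  rw [relEntropyZero_vecMulVec_star (h.unit_pow n), h1, Complex.ofReal_re,
    if_neg (pow_pos h.pos n).ne']

lemma thauma_eq (h : IsThaumaWitness e a D R) (n : ℕ) :
    thauma (tensorPow (ketProj e) n) = ((-Real.logb 2 (a ^ n) : ℝ) : EReal) :=
  le_antisymm ((iInf₂_le _ (h.mem_nonposMana n)).trans (h.relEntropy_eq n).le)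
    (le_iInf₂ fun _ hσ => h.le_relEntropy hσ)

lemma thaumaMax_eq (h : IsThaumaWitness e a D R) (n : ℕ) :
    thaumaMax (tensorPow (ketProj e) n) = ((-Real.logb 2 (a ^ n) : ℝ) : EReal) := by
  have ha : 0 < a ^ n := pow_pos h.pos n
  refine le_antisymm ((iInf₂_le _ (h.mem_nonposMana n)).trans (iInf₂_le _ ?_))
    (le_iInf₂ fun σ hσ => le_iInf₂ fun l hl => ?_)
  -- The choice λ = -log₂ a^n is feasible: it is a^{-n} times the inequality (aψ+R)^{⊗n} ≥ a^n
  -- ψ^{⊗n}.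
  · have h1 := posSemidef_tensorPow_add_sub h.posSemidef_smul h.posR n
    rw [tensorPow_smul] at h1
    have h2 : ((a ^ n)⁻¹ : ℂ) • (tensorPow ((a : ℂ) • ketProj e + R) n -
        (a : ℂ) ^ n • tensorPow (ketProj e) n) =
        (((2 : ℝ) ^ (-Real.logb 2 (a ^ n)) : ℝ) : ℂ) • tensorPow ((a : ℂ) • ketProj e + R) n -
        tensorPow (ketProj e) n := by
      rw [Real.rpow_neg (by norm_num), Real.rpow_logb (by norm_num) (by norm_num) ha, smul_sub,
        smul_smul, inv_mul_cancel₀ (by exact_mod_cast ha.ne'), one_smul]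
      push_cast
      rfl
    rw [← h2]
    exact h1.smul (by exact_mod_cast inv_nonneg.mpr ha.le)
  · rw [EReal.coe_le_coe_iff]
    -- Pairing 2^λσ - ψ^{⊗n} ≥ 0 with ψ^{⊗n} gives 1 ≤ 2^λ tr(ψ^{⊗n}σ) ≤ 2^λ a^n.
    have h1 := (posSemidef_tensorProd (n := n) fun _ => posSemidef_ketProj e).trace_mul_nonneg hl
    have h3 : (tensorPow (ketProj e) n * tensorPow (ketProj e) n).trace = 1 := by
      rw [tensorPow_ketProj, (isIdempotentElem_vecMulVec_star (h.unit_pow n)).eq,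
        Matrix.trace_vecMulVec, dotProduct_comm, h.unit_pow]
    rw [← tensorPow_eq_tensorProd, Matrix.mul_sub, Matrix.trace_sub, h3, Matrix.mul_smul,
      Matrix.trace_smul, sub_nonneg, smul_eq_mul] at h1
    have h4 := (Complex.le_def.mp h1).1
    rw [Complex.re_ofReal_mul, Complex.one_re] at h4
    have h5 : (0 : ℝ) < 2 ^ l := Real.rpow_pos_of_pos (by norm_num) l
    have h6 : 1 ≤ 2 ^ l * a ^ n := h4.trans (mul_le_mul_of_nonneg_left (h.trace_le hσ) h5.le)
    rw [← Real.logb_inv, Real.logb_le_iff_le_rpow (by norm_num) (inv_pos.mpr ha),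
      inv_le_iff_one_le_mul₀ ha]
    exact h6

lemma tendsto_div {f : ℕ → EReal} (hf : ∀ n, f n = ((-Real.logb 2 (a ^ n) : ℝ) : EReal)) :
    Tendsto (fun n : ℕ => f n / (n : EReal)) atTop (𝓝 ((Real.logb 2 a⁻¹ : ℝ) : EReal)) := by
  refine tendsto_const_nhds.congr' ?_
  -- The quotient is constant except at n = 0, where it divides by zero.
  filter_upwards [eventually_ge_atTop 1] with n hn
  have hn0 : (n : ℝ) ≠ 0 := by positivity
  rw [hf, show (n : EReal) = ((n : ℝ) : EReal) from rfl, ← EReal.coe_div, EReal.coe_eq_coe_iff,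
    Real.logb_inv, Real.logb_pow]
  field_simp

lemma hasRegThauma (h : IsThaumaWitness e a D R) :
    HasRegThauma (ketProj e) ((Real.logb 2 a⁻¹ : ℝ) : EReal) :=
  tendsto_div h.thauma_eq

lemma thauma_equalities (h : IsThaumaWitness e a D R) {b : ℝ} (hb : a⁻¹ = b) :
    thaumaMin (tensorPow (ketProj e) 1) = ((Real.logb 2 b : ℝ) : EReal) ∧
      HasRegThauma (ketProj e) ((Real.logb 2 b : ℝ) : EReal) ∧
      thaumaMax (tensorPow (ketProj e) 1) = ((Real.logb 2 b : ℝ) : EReal) := by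
  subst hb
  refine ⟨?_, h.hasRegThauma, ?_⟩
  · rw [h.thaumaMin_eq, pow_one, Real.logb_inv]
  · rw [h.thaumaMax_eq, pow_one, Real.logb_inv]

lemma hasRegRelEntropyMagic (h : IsThaumaWitness e a D R)
    (hstab : ∀ n, stabStates 3 n ⊆ nonposMana 3 n)
    (hR : ∀ n, tensorPow ((a : ℂ) • ketProj e + R) n ∈ stabStates 3 n) :
    HasRegRelEntropyMagic (ketProj e) ((Real.logb 2 a⁻¹ : ℝ) : EReal) :=
  tendsto_div fun n =>
    le_antisymm ((iInf₂_le _ (hR n)).trans (h.relEntropy_eq n).le)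
      (le_iInf₂ fun _ hσ => h.le_relEntropy (hstab n hσ))

end IsThaumaWitness

end Witness

/-! ### Phase-space expectations of one-qutrit operators -/

section QutritWitnesses

lemma sum_zmod_three {M : Type*} [AddCommMonoid M] (f : ZMod 3 → M) :
    ∑ i, f i = f 0 + f 1 + f 2 :=
  Fin.sum_univ_three f

/-- A_{(p,q)} is the reflection q + i ↦ q - i with phases, so it has three nonzero entries and meets
only three entries of M. -/
lemma trace_phasePointOne_mul (u : ZMod 3 × ZMod 3) (M : Matrix (ZMod 3) (ZMod 3) ℂ) :
    (phasePointOne u * M).trace = M u.2 u.2 + ZMod.stdAddChar u.1 * M (u.2 + 1) (u.2 - 1) +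
      ZMod.stdAddChar (-u.1) * M (u.2 - 1) (u.2 + 1) := by
  obtain ⟨p, q⟩ := u
  have h1 : ∀ i, ∑ j, phasePointOne (p, q) (i + q) j * M j (i + q) =
      ZMod.stdAddChar (p * (2 * i)) * M (q - i) (i + q) := by
    intro i
    rw [Finset.sum_eq_single (q - i)]
    · rw [phasePointOne_apply, if_pos (by ring)]
      congr 3
      ring
    · intro j _ hj
      rw [phasePointOne_apply, if_neg fun h => hj ?_, zero_mul]
      linear_combination h
    · simp
  simp only [Matrix.trace, Matrix.diag, Matrix.mul_apply]
  rw [← Equiv.sum_comp (Equiv.addRight q)]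
  simp only [Equiv.coe_addRight, h1]
  rw [sum_zmod_three]
  have h3 : (3 : ZMod 3) = 0 := rfl
  have e1 : q - 2 = q + 1 := by linear_combination -h3
  have e2 : 2 + q = q - 1 := by linear_combination h3
  have e3 : p * (2 * 1) = -p := by linear_combination p * h3
  have e4 : p * (2 * 2) = p := by linear_combination p * h3
  rw [e1, e2, e3, e4, mul_zero, mul_zero, AddChar.map_zero_eq_one, one_mul, sub_zero, zero_add,
    add_comm 1 q]
  ring

lemma stdAddChar_add_neg (p : ZMod 3) :
    (ZMod.stdAddChar p : ℂ) + ZMod.stdAddChar (-p) =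
      ((if p = 0 then 2 else -1 : ℝ) : ℂ) := by
  have h := sum_stdAddChar_mul 1
  rw [sum_zmod_three, if_neg (by decide)] at h
  simp only [mul_one, AddChar.map_zero_eq_one] at h
  have hp : p = 0 ∨ p = 1 ∨ p = 2 := by revert p; decide
  rcases hp with rfl | rfl | rfl
  · simp only [neg_zero, AddChar.map_zero_eq_one, if_true]
    norm_num
  · rw [if_neg (by decide), Complex.ofReal_neg, Complex.ofReal_one, show (-1 : ZMod 3) = 2 by decide]
    linear_combination h
  · rw [if_neg (by decide), Complex.ofReal_neg, Complex.ofReal_one, show (-2 : ZMod 3) = 1 by decide]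
    linear_combination h

/-- The phase-space expectations of a real symmetric operator. -/
lemma norm_trace_phasePointOne_mul_ofReal {m : ZMod 3 → ZMod 3 → ℝ} (hm : ∀ i j, m i j = m j i)
    (u : ZMod 3 × ZMod 3) :
    ‖(phasePointOne u * Matrix.of fun i j => ((m i j : ℝ) : ℂ)).trace‖ =
      |m u.2 u.2 + (if u.1 = 0 then 2 else -1) * m (u.2 + 1) (u.2 - 1)| := by
  rw [trace_phasePointOne_mul, ← Real.norm_eq_abs, ← Complex.norm_real]
  congr 1
  simp only [Matrix.of_apply, hm (u.2 - 1)]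
  rw [Complex.ofReal_add, Complex.ofReal_mul, ← stdAddChar_add_neg u.1]
  ring

lemma forall_zmod_three {P : ZMod 3 → Prop} : (∀ i, P i) ↔ P 0 ∧ P 1 ∧ P 2 :=
  ⟨fun h => ⟨h 0, h 1, h 2⟩, fun h i => by
    have hi : i = 0 ∨ i = 1 ∨ i = 2 := by clear h; revert i; decide
    rcases hi with rfl | rfl | rfl
    exacts [h.1, h.2.1, h.2.2]⟩

/-- The real symmetric function on `ZMod 3 × ZMod 3` with the given entries. -/
def symmEntries (a b c x y z : ℝ) : ZMod 3 → ZMod 3 → ℝ :=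
  !![a, z, y; z, b, x; y, x, c]

lemma symmEntries_comm (a b c x y z : ℝ) (i j : ZMod 3) :
    symmEntries a b c x y z i j = symmEntries a b c x y z j i := by
  revert j
  revert i
  simp only [forall_zmod_three]
  exact ⟨⟨trivial, rfl, rfl⟩, ⟨rfl, trivial, rfl⟩, rfl, rfl, trivial⟩

/-- The operator of one qutrit with real symmetric entries. -/
def symmOp (a b c x y z : ℝ) : Matrix (ZMod 3) (ZMod 3) ℂ :=
  Matrix.of fun i j => ((symmEntries a b c x y z i j : ℝ) : ℂ)

/-- The reflection about a position fixes it and swaps the other two, so each diagonal entry meets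
the off-diagonal entry that avoids its index (a with x, b with y, c with z), with coefficient 2 if
the boost coordinate is 0 and -1 otherwise. -/
lemma norm_trace_phasePointOne_mul_symmOp_le {a b c x y z v : ℝ} (h0 : |a + 2 * x| ≤ v)
    (h0' : |a - x| ≤ v) (h1 : |b + 2 * y| ≤ v) (h1' : |b - y| ≤ v) (h2 : |c + 2 * z| ≤ v)
    (h2' : |c - z| ≤ v) (u : ZMod 3 × ZMod 3) :
    ‖(phasePointOne u * symmOp a b c x y z).trace‖ ≤ v := by
  rw [symmOp, norm_trace_phasePointOne_mul_ofReal (symmEntries_comm a b c x y z)]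
  obtain ⟨p, q⟩ := u
  have hq : q = 0 ∨ q = 1 ∨ q = 2 := by revert q; decide
  split_ifs
  · rcases hq with rfl | rfl | rfl
    exacts [h0, h1, h2]
  · rw [neg_one_mul, ← sub_eq_add_neg]
    rcases hq with rfl | rfl | rfl
    exacts [h0', h1', h2']

lemma sum_norm_trace_phasePointOne_mul_symmOp (a b c x y z : ℝ) :
    ∑ u, ‖(phasePointOne u * symmOp a b c x y z).trace‖ =
      (|a + 2 * x| + 2 * |a - x|) + (|b + 2 * y| + 2 * |b - y|) + (|c + 2 * z| + 2 * |c - z|) := by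
  simp only [symmOp, norm_trace_phasePointOne_mul_ofReal (symmEntries_comm a b c x y z)]
  rw [Fintype.sum_prod_type_right]
  simp only [sum_zmod_three, if_true, if_neg (show (1 : ZMod 3) ≠ 0 by decide),
    if_neg (show (2 : ZMod 3) ≠ 0 by decide), neg_one_mul, ← sub_eq_add_neg, add_assoc, ← two_mul]
  rfl

lemma qutritKet_zero (a b c : ℂ) : qutritKet a b c 0 = a := rfl

lemma qutritKet_one (a b c : ℂ) : qutritKet a b c 1 = b := rfl

lemma qutritKet_two (a b c : ℂ) : qutritKet a b c 2 = c := rfl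

lemma ketProj_ofReal (a b c : ℝ) :
    ketProj (qutritKet a b c) = symmOp (a * a) (b * b) (c * c) (b * c) (a * c) (a * b) := by
  ext i j
  revert j
  revert i
  simp only [forall_zmod_three]
  simp only [ketProj, vecMulVec_apply, Pi.star_apply, qutritKet_zero, qutritKet_one, qutritKet_two,
    RCLike.star_def, Complex.conj_ofReal, ← Complex.ofReal_mul]
  refine ⟨⟨rfl, rfl, rfl⟩, ⟨?_, rfl, rfl⟩, ?_, ?_, rfl⟩
  exacts [congrArg _ (mul_comm b a), congrArg _ (mul_comm c a), congrArg _ (mul_comm c b)]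

lemma ketProj_ofReal_smul (r : ℝ) (f : ZMod 3 → ℂ) :
    ketProj ((r : ℂ)⁻¹ • f) = (((r ^ 2)⁻¹ : ℝ) : ℂ) • ketProj f := by
  ext i j
  simp only [ketProj, vecMulVec_apply, Pi.star_apply, Pi.smul_apply, Matrix.smul_apply, smul_eq_mul,
    star_mul', star_inv₀, RCLike.star_def, Complex.conj_ofReal]
  push_cast
  ring

lemma smul_symmOp (r a b c x y z : ℝ) :
    (r : ℂ) • symmOp a b c x y z = symmOp (r * a) (r * b) (r * c) (r * x) (r * y) (r * z) := by
  ext i j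
  revert j
  revert i
  simp only [forall_zmod_three, Matrix.smul_apply, smul_eq_mul, symmOp, Matrix.of_apply,
    ← Complex.ofReal_mul]
  exact ⟨⟨rfl, rfl, rfl⟩, ⟨rfl, rfl, rfl⟩, rfl, rfl, rfl⟩

lemma symmOp_add_symmOp (a b c x y z a' b' c' x' y' z' : ℝ) :
    symmOp a b c x y z + symmOp a' b' c' x' y' z' =
      symmOp (a + a') (b + b') (c + c') (x + x') (y + y') (z + z') := by
  ext i j
  revert j
  revert i
  simp only [forall_zmod_three, Matrix.add_apply, symmOp, Matrix.of_apply, ← Complex.ofReal_add]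
  exact ⟨⟨rfl, rfl, rfl⟩, ⟨rfl, rfl, rfl⟩, rfl, rfl, rfl⟩

end QutritWitnesses

/-! ### Witnesses for the strange state, the Norrell state and the Hadamard eigenstate -/

section RealWitnesses

lemma posSemidef_smul_ketProj {c : ℝ} (hc : 0 ≤ c) (f : ZMod 3 → ℂ) :
    ((c : ℂ) • ketProj f).PosSemidef :=
  (posSemidef_ketProj f).smul (by exact_mod_cast hc)

lemma smul_ketProj_mulVec_eq_zero (c : ℂ) {f e : ZMod 3 → ℂ} (h : star f ⬝ᵥ e = 0) :
    (c • ketProj f) *ᵥ e = 0 := by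
  rw [Matrix.smul_mulVec, ketProj, Matrix.vecMulVec_mulVec, h]
  simp

lemma star_qutritKet_dotProduct (a b c a' b' c' : ℂ) :
    star (qutritKet a b c) ⬝ᵥ qutritKet a' b' c' = star a * a' + star b * b' + star c * c' :=
  sum_zmod_three _

lemma unit_of_ofReal {r a b c : ℝ} (hr : r ≠ 0) (h : a ^ 2 + b ^ 2 + c ^ 2 = r ^ 2) :
    star ((r : ℂ)⁻¹ • qutritKet a b c) ⬝ᵥ ((r : ℂ)⁻¹ • qutritKet a b c) = 1 := by
  have hr' : (r : ℂ) ≠ 0 := by exact_mod_cast hr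
  have h' : (a : ℂ) ^ 2 + (b : ℂ) ^ 2 + (c : ℂ) ^ 2 = (r : ℂ) ^ 2 := by exact_mod_cast h
  rw [star_smul, smul_dotProduct, dotProduct_smul, star_qutritKet_dotProduct]
  simp only [RCLike.star_def, Complex.conj_ofReal, star_inv₀, smul_eq_mul]
  field_simp
  linear_combination h'

lemma ketStrange_eq :
    ketStrange = ((Real.sqrt 2 : ℝ) : ℂ)⁻¹ • qutritKet (0 : ℝ) (1 : ℝ) (-1 : ℝ) := by
  simp [ketStrange]

lemma ketNorrell_eq :
    ketNorrell = ((Real.sqrt 6 : ℝ) : ℂ)⁻¹ • qutritKet (-1 : ℝ) (2 : ℝ) (-1 : ℝ) := by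
  simp [ketNorrell]

lemma ketHPlus_eq :
    ketHPlus = ((Real.sqrt (2 * (3 + Real.sqrt 3)) : ℝ) : ℂ)⁻¹ •
      qutritKet (1 + Real.sqrt 3 : ℝ) (1 : ℝ) (1 : ℝ) := by
  simp [ketHPlus]

lemma ketProj_ketStrange : ketProj ketStrange = symmOp 0 (1 / 2) (1 / 2) (-(1 / 2)) 0 0 := by
  rw [ketStrange_eq, ketProj_ofReal_smul, ketProj_ofReal, smul_symmOp, Real.sq_sqrt (by norm_num)]
  norm_num

lemma ketProj_ketNorrell :
    ketProj ketNorrell = symmOp (1 / 6) (2 / 3) (1 / 6) (-(1 / 3)) (1 / 6) (-(1 / 3)) := by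
  rw [ketNorrell_eq, ketProj_ofReal_smul, ketProj_ofReal, smul_symmOp, Real.sq_sqrt (by norm_num)]
  norm_num

lemma sqrt_three_sq : Real.sqrt 3 * Real.sqrt 3 = 3 := Real.mul_self_sqrt (by norm_num)

lemma ketProj_ketHPlus :
    ketProj ketHPlus = symmOp ((3 + Real.sqrt 3) / 6) ((3 - Real.sqrt 3) / 12)
      ((3 - Real.sqrt 3) / 12) ((3 - Real.sqrt 3) / 12) (Real.sqrt 3 / 6) (Real.sqrt 3 / 6) := by
  have h3 := sqrt_three_sq
  have h : (2 * (3 + Real.sqrt 3))⁻¹ = (3 - Real.sqrt 3) / 12 := by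
    refine inv_eq_of_mul_eq_one_right ?_
    linear_combination -h3 / 6
  rw [ketHPlus_eq, ketProj_ofReal_smul, ketProj_ofReal, smul_symmOp, Real.sq_sqrt (by positivity), h]
  congr 1
  · linear_combination (1 - Real.sqrt 3) / 12 * h3
  · ring
  · ring
  · ring
  · linear_combination -h3 / 12
  · linear_combination -h3 / 12

/-- D flattens the expectations of the state to modulus 3/5 at all nine points. The Wigner trace
norm of the state is 5/3, so rescaling alone reaches norm 1 and R = 0 suffices. -/
lemma isThaumaWitness_ketStrange :
    IsThaumaWitness ketStrange (3 / 5)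
      (((1 / 5 : ℝ) : ℂ) • ketProj (qutritKet (1 : ℝ) (0 : ℝ) (0 : ℝ)) +
        ((1 / 10 : ℝ) : ℂ) • ketProj (qutritKet (0 : ℝ) (1 : ℝ) (1 : ℝ))) 0 where
  unit := by
    rw [ketStrange_eq]
    exact unit_of_ofReal (by positivity) (by rw [Real.sq_sqrt (by norm_num)]; norm_num)
  pos := by norm_num
  posD := (posSemidef_smul_ketProj (by norm_num) _).add (posSemidef_smul_ketProj (by norm_num) _)
  bound u := by
    rw [ketProj_ketStrange, ketProj_ofReal, ketProj_ofReal, smul_symmOp, smul_symmOp,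
      symmOp_add_symmOp, symmOp_add_symmOp]
    apply norm_trace_phasePointOne_mul_symmOp_le <;> norm_num [abs_le]
  posR := Matrix.PosSemidef.zero
  orth := Matrix.zero_mulVec _
  norm_le := by
    rw [add_zero, ketProj_ketStrange, smul_symmOp, sum_norm_trace_phasePointOne_mul_symmOp]
    norm_num [abs_of_pos, abs_of_neg]

/-- The optimal operator of non-positive mana for the Norrell state. -/
lemma smul_ketProj_ketNorrell_add :
    (((2 / 3 : ℝ) : ℂ) • ketProj ketNorrell +
      ((1 / 9 : ℝ) : ℂ) • ketProj (qutritKet (1 : ℝ) (1 : ℝ) (1 : ℝ))) =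
    symmOp (2 / 9) (5 / 9) (2 / 9) (-1 / 9) (2 / 9) (-1 / 9) := by
  rw [ketProj_ketNorrell, ketProj_ofReal, smul_symmOp, smul_symmOp, symmOp_add_symmOp]
  norm_num

/-- D brings the expectations to 2/3 or -1/3. R is a multiple of the projector onto the uniform
vector, orthogonal to the state, and cancels the negative part of its Wigner function. -/
lemma isThaumaWitness_ketNorrell :
    IsThaumaWitness ketNorrell (2 / 3)
      (((1 / 6 : ℝ) : ℂ) • ketProj (qutritKet (1 : ℝ) (0 : ℝ) (-1 : ℝ)))
      (((1 / 9 : ℝ) : ℂ) • ketProj (qutritKet (1 : ℝ) (1 : ℝ) (1 : ℝ))) where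
  unit := by
    rw [ketNorrell_eq]
    exact unit_of_ofReal (by positivity) (by rw [Real.sq_sqrt (by norm_num)]; norm_num)
  pos := by norm_num
  posD := posSemidef_smul_ketProj (by norm_num) _
  bound u := by
    rw [ketProj_ketNorrell, ketProj_ofReal, smul_symmOp, symmOp_add_symmOp]
    apply norm_trace_phasePointOne_mul_symmOp_le <;> norm_num [abs_le]
  posR := posSemidef_smul_ketProj (by norm_num) _
  orth := by
    refine smul_ketProj_mulVec_eq_zero _ ?_
    rw [ketNorrell_eq, dotProduct_smul, star_qutritKet_dotProduct]
    norm_num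
  norm_le := by
    rw [smul_ketProj_ketNorrell_add,
      sum_norm_trace_phasePointOne_mul_symmOp]
    norm_num [abs_of_pos, abs_of_neg]

/-- The optimal operator of non-positive mana for the Hadamard eigenstate. -/
lemma smul_ketProj_ketHPlus_add :
    (((3 + Real.sqrt 3) / 6 : ℝ) : ℂ) • ketProj ketHPlus +
      (((2 - Real.sqrt 3) / 24 : ℝ) : ℂ) •
        ketProj (qutritKet (-2 : ℝ) (1 + Real.sqrt 3 : ℝ) (1 + Real.sqrt 3 : ℝ)) =
    symmOp (2 / 3) (1 / 6) (1 / 6) (1 / 6) (1 / 6) (1 / 6) := by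
  have h3 := sqrt_three_sq
  rw [ketProj_ketHPlus, ketProj_ofReal, smul_symmOp, smul_symmOp, symmOp_add_symmOp]
  congr 1
  · linear_combination h3 / 36
  · linear_combination (-Real.sqrt 3 / 24 - 1 / 72) * h3
  · linear_combination (-Real.sqrt 3 / 24 - 1 / 72) * h3
  · linear_combination (-Real.sqrt 3 / 24 - 1 / 72) * h3
  · linear_combination h3 / 9
  · linear_combination h3 / 9

/-- D removes the coherence between |1⟩ and |2⟩. R lives on the -1-eigenvector of the Hadamard gate;
the resulting aψ+R is the even mixture of |0⟩ and the uniform superposition. -/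
lemma isThaumaWitness_ketHPlus :
    IsThaumaWitness ketHPlus ((3 + Real.sqrt 3) / 6)
      ((((3 - Real.sqrt 3) / 12 : ℝ) : ℂ) • ketProj (qutritKet (0 : ℝ) (1 : ℝ) (-1 : ℝ)))
      ((((2 - Real.sqrt 3) / 24 : ℝ) : ℂ) •
        ketProj (qutritKet (-2 : ℝ) (1 + Real.sqrt 3 : ℝ) (1 + Real.sqrt 3 : ℝ))) := by
  have h3 := sqrt_three_sq
  have hr : 0 ≤ Real.sqrt 3 := Real.sqrt_nonneg 3
  have hr2 : Real.sqrt 3 < 2 := by nlinarith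
  constructor
  · rw [ketHPlus_eq]
    refine unit_of_ofReal (by positivity) ?_
    rw [Real.sq_sqrt (by positivity)]
    linear_combination h3
  · positivity
  · exact posSemidef_smul_ketProj (by linarith) _
  · intro u
    rw [ketProj_ketHPlus, ketProj_ofReal, smul_symmOp, symmOp_add_symmOp]
    apply norm_trace_phasePointOne_mul_symmOp_le <;> rw [abs_le] <;> constructor <;> linarith
  · exact posSemidef_smul_ketProj (by linarith) _
  · refine smul_ketProj_mulVec_eq_zero _ ?_
    rw [ketHPlus_eq, dotProduct_smul, star_qutritKet_dotProduct]
    simp only [RCLike.star_def, Complex.conj_ofReal, ← Complex.ofReal_mul, ← Complex.ofReal_add]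
    rw [show -2 * (1 + Real.sqrt 3) + (1 + Real.sqrt 3) * 1 + (1 + Real.sqrt 3) * 1 = 0 by ring]
    simp
  · rw [smul_ketProj_ketHPlus_add, sum_norm_trace_phasePointOne_mul_symmOp]
    norm_num [abs_of_pos]

end RealWitnesses

/-! ### Witnesses for the magic state of the qutrit `T` gate -/

section PhaseKets

/-- The standard additive character of `ℤ/9`, whose value at `1` is `ξ`. -/
local notation "Θ" => (ZMod.stdAddChar : AddChar (ZMod 9) ℂ)

lemma stdAddChar_nine_natCast (j : ℕ) : Θ j = xi ^ j := by
  have := ZMod.stdAddChar_coe (N := 9) j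
  rw [Int.cast_natCast] at this
  rw [this, xi, ← Complex.exp_nat_mul]
  congr 1
  push_cast
  ring

/-- The embedding of `ℤ/3` in `ℤ/9`. -/
def tripleEmb (p : ZMod 3) : ZMod 9 := ((3 * p.val : ℕ) : ZMod 9)

lemma stdAddChar_three_eq (p : ZMod 3) : (ZMod.stdAddChar p : ℂ) = Θ (tripleEmb p) := by
  rw [tripleEmb, stdAddChar_nine_natCast, ← omega_pow_val, xi, omega,
    ← Complex.exp_nat_mul, ← Complex.exp_nat_mul]
  congr 1
  push_cast
  ring

/-! ### Arithmetic of the numbers 2 cos(2πm/9) -/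

/-- `2 cos (2πm/9)`. -/
noncomputable def twoCos (m : ZMod 9) : ℝ := 2 * (Θ m).re

lemma twoCos_eq (m : ZMod 9) : ((twoCos m : ℝ) : ℂ) = Θ m + Θ (-m) := by
  rw [AddChar.map_neg_eq_conj, Complex.add_conj, twoCos]

lemma twoCos_neg (m : ZMod 9) : twoCos (-m) = twoCos m := by
  have h := twoCos_eq (-m)
  rw [neg_neg, add_comm, ← twoCos_eq] at h
  exact_mod_cast h

lemma stdAddChar_nine_mul_neg (m : ZMod 9) : Θ m * Θ (-m) = 1 := by
  rw [← AddChar.map_add_eq_mul, add_neg_cancel, AddChar.map_zero_eq_one]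

lemma twoCos_two_mul (m : ZMod 9) : twoCos (2 * m) = twoCos m ^ 2 - 2 := by
  have h : ((twoCos (2 * m) : ℝ) : ℂ) = (twoCos m : ℂ) ^ 2 - 2 := by
    rw [twoCos_eq, twoCos_eq, two_mul, neg_add, AddChar.map_add_eq_mul, AddChar.map_add_eq_mul]
    linear_combination -2 * stdAddChar_nine_mul_neg m
  exact_mod_cast h

lemma twoCos_three_mul (m : ZMod 9) : twoCos (3 * m) = twoCos m ^ 3 - 3 * twoCos m := by
  have h : ((twoCos (3 * m) : ℝ) : ℂ) = (twoCos m : ℂ) ^ 3 - 3 * twoCos m := by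
    rw [twoCos_eq, twoCos_eq, show 3 * m = m + m + m by ring, neg_add, neg_add]
    simp only [AddChar.map_add_eq_mul]
    linear_combination (-3 * Θ m - 3 * Θ (-m)) * stdAddChar_nine_mul_neg m
  exact_mod_cast h

lemma twoCos_two : twoCos 2 = 2 * Real.sin (Real.pi / 18) := by
  rw [twoCos, show (2 : ZMod 9) = ((2 : ℤ) : ZMod 9) by norm_num, ZMod.stdAddChar_coe,
    show 2 * (Real.pi : ℂ) * Complex.I * ((2 : ℤ) : ℂ) / ((9 : ℕ) : ℂ) =
      ((4 * Real.pi / 9 : ℝ) : ℂ) * Complex.I by push_cast; ring,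
    Complex.exp_ofReal_mul_I_re, ← Real.cos_pi_div_two_sub]
  congr 2
  ring

/-- The triple-angle formula at m = 2: ξ⁶ is a primitive cube root of unity, so `twoCos 6` is -1.
All later identities for T reduce modulo this cubic. -/
lemma twoCos_two_cubic : twoCos 2 ^ 3 = 3 * twoCos 2 - 1 := by
  have h : twoCos 6 = -1 := by
    have h1 := stdAddChar_add_neg 2
    rw [if_neg (by decide), stdAddChar_three_eq, stdAddChar_three_eq,
      show tripleEmb 2 = 6 by decide, show tripleEmb (-2) = -6 by decide, ← twoCos_eq] at h1
    exact_mod_cast h1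
  have h2 := twoCos_three_mul 2
  rw [show (3 * 2 : ZMod 9) = 6 by decide, h] at h2
  linear_combination -h2

lemma twoCos_four : twoCos 4 = twoCos 2 ^ 2 - 2 := by
  rw [← twoCos_two_mul]
  rfl

lemma twoCos_one : twoCos 1 = 2 - twoCos 2 - twoCos 2 ^ 2 := by
  rw [← twoCos_neg, show (-1 : ZMod 9) = 2 * 4 by decide, twoCos_two_mul, twoCos_four]
  linear_combination twoCos 2 * twoCos_two_cubic

lemma twoCos_two_pos : 0 < twoCos 2 := by
  rw [twoCos_two]
  have := Real.sin_pos_of_pos_of_lt_pi (x := Real.pi / 18) (by positivity)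
    (by linarith [Real.pi_pos])
  positivity

lemma twoCos_two_lt_one : twoCos 2 < 1 := by
  rw [twoCos_two]
  have h := Real.sin_lt (x := Real.pi / 18) (by positivity)
  linarith [Real.pi_lt_four]

/-! ### The orthonormal basis Z^k|T⟩ and its phase-space expectations -/

/-- The exponents of `ξ` in the vectors `Z^k |T⟩`. -/
def phaseExp (k : ZMod 3) (j : ZMod 3) : ZMod 9 :=
  (if j = 0 then 1 else if j = 1 then 0 else -1) + tripleEmb (k * j)

/-- The vectors `Z^k |T⟩`. -/
noncomputable def phaseKet (k : ZMod 3) : ZMod 3 → ℂ := ((Real.sqrt 3 : ℝ) : ℂ)⁻¹ • fun j => Θ (phaseExp k j)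

lemma ketT_eq : ketT = phaseKet 0 := by
  have h1 : Θ 1 = xi := by simpa using stdAddChar_nine_natCast 1
  have h2 : Θ (-1) = xi⁻¹ := by rw [AddChar.map_neg_eq_inv, h1]
  rw [ketT, phaseKet]
  congr 1
  ext j
  revert j
  rw [forall_zmod_three, qutritKet_zero, qutritKet_one, qutritKet_two]
  rw [show phaseExp 0 0 = 1 by decide, show phaseExp 0 1 = 0 by decide,
    show phaseExp 0 2 = -1 by decide, h1, h2, AddChar.map_zero_eq_one]
  exact ⟨rfl, rfl, rfl⟩

lemma ketProj_phaseKet_apply (k i j : ZMod 3) :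
    ketProj (phaseKet k) i j = 3⁻¹ * Θ (phaseExp k i - phaseExp k j) := by
  rw [phaseKet, ketProj_ofReal_smul, Real.sq_sqrt (by norm_num), Matrix.smul_apply, ketProj,
    vecMulVec_apply, Pi.star_apply, sub_eq_add_neg, AddChar.map_add_eq_mul,
    AddChar.map_neg_eq_conj]
  simp

/-- The exponent of `ξ` in the phase-space expectations of `Z^k |T⟩`. -/
def phaseSpaceExp (k : ZMod 3) (u : ZMod 3 × ZMod 3) : ZMod 9 :=
  tripleEmb u.1 + (phaseExp k (u.2 + 1) - phaseExp k (u.2 - 1))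

lemma trace_phasePointOne_mul_ketProj_phaseKet (k : ZMod 3) (u : ZMod 3 × ZMod 3) :
    (phasePointOne u * ketProj (phaseKet k)).trace =
      (((1 + twoCos (phaseSpaceExp k u)) / 3 : ℝ) : ℂ) := by
  have h : tripleEmb (-u.1) = -tripleEmb u.1 := by
    generalize u.1 = p
    revert p
    decide
  rw [trace_phasePointOne_mul]
  simp only [ketProj_phaseKet_apply]
  push_cast
  rw [twoCos_eq, phaseSpaceExp, neg_add, neg_sub, AddChar.map_add_eq_mul, AddChar.map_add_eq_mul,
    sub_self, AddChar.map_zero_eq_one, stdAddChar_three_eq, stdAddChar_three_eq, h]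
  ring

lemma star_phaseKet_dotProduct (k l : ZMod 3) :
    star (phaseKet k) ⬝ᵥ phaseKet l = if k = l then 1 else 0 := by
  have h3 : ((Real.sqrt 3 : ℝ) : ℂ) * ((Real.sqrt 3 : ℝ) : ℂ) = 3 := by
    exact_mod_cast sqrt_three_sq
  have h0 : ((Real.sqrt 3 : ℝ) : ℂ) ≠ 0 := by
    intro h
    rw [h] at h3
    norm_num at h3
  have h : ∀ j, star (phaseKet k j) * phaseKet l j = 3⁻¹ * ZMod.stdAddChar (j * (l - k)) := by
    intro j
    have h1 : tripleEmb (j * (l - k)) = -phaseExp k j + phaseExp l j := by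
      revert j k l
      decide
    rw [phaseKet, phaseKet, Pi.smul_apply, Pi.smul_apply, smul_eq_mul, smul_eq_mul, star_mul',
      stdAddChar_three_eq, h1, AddChar.map_add_eq_mul, AddChar.map_neg_eq_conj, ← h3]
    simp only [star_inv₀, RCLike.star_def, Complex.conj_ofReal]
    field_simp
  simp only [dotProduct, Pi.star_apply, h]
  rw [← Finset.mul_sum, sum_stdAddChar_mul]
  simp only [sub_eq_zero, eq_comm (a := l)]
  split_ifs <;> simp

lemma trace_phasePointOne_mul_add (a b : ℝ) (k l : ZMod 3) (u : ZMod 3 × ZMod 3) :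
    ‖(phasePointOne u * ((a : ℂ) • ketProj (phaseKet k) + (b : ℂ) • ketProj (phaseKet l))).trace‖ =
      |a * ((1 + twoCos (phaseSpaceExp k u)) / 3) + b * ((1 + twoCos (phaseSpaceExp l u)) / 3)| := by
  rw [Matrix.mul_add, Matrix.trace_add, Matrix.mul_smul, Matrix.mul_smul, Matrix.trace_smul,
    Matrix.trace_smul, trace_phasePointOne_mul_ketProj_phaseKet,
    trace_phasePointOne_mul_ketProj_phaseKet, smul_eq_mul, smul_eq_mul, ← Complex.ofReal_mul,
    ← Complex.ofReal_mul, ← Complex.ofReal_add, Complex.norm_real, Real.norm_eq_abs]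

/-- The expectations of Z^k|T⟩ are (1 + 2cos(2πm/9))/3 with m cycling through 1, 4, -2; only m = 4
is negative. With x = 2cos(4π/9), adding x times the projector onto Z|T⟩ lifts these negative values
exactly to 0, while D uses Z²|T⟩ to lower the peaks at m = 1. -/
lemma isThaumaWitness_ketT :
    IsThaumaWitness ketT (1 + twoCos 2)⁻¹ ((twoCos 2 : ℂ) • ketProj (phaseKet 2))
      ((((1 + twoCos 2)⁻¹ * twoCos 2 : ℝ) : ℂ) • ketProj (phaseKet 1)) := by
  have hx0 := twoCos_two_pos
  have hx1 := twoCos_two_lt_one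
  have hx3 := twoCos_two_cubic
  have h1 := twoCos_one
  have h4 := twoCos_four
  set x := twoCos 2 with hx
  -- By the cubic, (1 + x)(2 + x - x²) = 2 + 3x - x³ = 3.
  have ha : (1 + x)⁻¹ = (2 + x - x ^ 2) / 3 := by
    refine inv_eq_of_mul_eq_one_right ?_
    linear_combination -hx3 / 3
  have ha0 : 0 < (1 + x)⁻¹ := by positivity
  have h1' : twoCos (-1) = 2 - x - x ^ 2 := by rw [twoCos_neg, h1]
  have h2' : twoCos (-2) = x := by rw [twoCos_neg]
  have h4' : twoCos (-4) = x ^ 2 - 2 := by rw [twoCos_neg, h4]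
  rw [ketT_eq]
  constructor
  · rw [star_phaseKet_dotProduct, if_pos rfl]
  · exact ha0
  · exact posSemidef_smul_ketProj hx0.le _
  · intro u
    have key := trace_phasePointOne_mul_add 1 x 0 2 u
    rw [Complex.ofReal_one, one_smul] at key
    rw [key]
    -- Up to signs, which `twoCos` ignores, only the pairs (1,4), (4,2), (2,1) occur; they are
    -- bounded by `b1`, `b2`, `b3`.
    have hu : (phaseSpaceExp 0 u, phaseSpaceExp 2 u) ∈
        ({(1, 4), (1, -4), (-1, 4), (-1, -4), (4, 2), (4, -2), (-4, 2), (-4, -2), (2, 1), (2, -1),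
          (-2, 1), (-2, -1)} : Finset (ZMod 9 × ZMod 9)) := by
      clear key
      revert u
      decide
    have b1 : |1 * ((1 + (2 - x - x ^ 2)) / 3) + x * ((1 + (x ^ 2 - 2)) / 3)| ≤ (1 + x)⁻¹ := by
      rw [show 1 * ((1 + (2 - x - x ^ 2)) / 3) + x * ((1 + (x ^ 2 - 2)) / 3) = (1 + x)⁻¹ by
        rw [ha]; linear_combination hx3 / 3, abs_of_pos ha0]
    have b2 : |1 * ((1 + (x ^ 2 - 2)) / 3) + x * ((1 + x) / 3)| ≤ (1 + x)⁻¹ := by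
      rw [ha, abs_le]
      constructor <;> nlinarith
    have b3 : |1 * ((1 + x) / 3) + x * ((1 + (2 - x - x ^ 2)) / 3)| ≤ (1 + x)⁻¹ := by
      rw [show 1 * ((1 + x) / 3) + x * ((1 + (2 - x - x ^ 2)) / 3) = (1 + x)⁻¹ by
        rw [ha]; linear_combination -hx3 / 3, abs_of_pos ha0]
    simp only [Finset.mem_insert, Finset.mem_singleton, Prod.mk.injEq] at hu
    rcases hu with ⟨e, f⟩ | ⟨e, f⟩ | ⟨e, f⟩ | ⟨e, f⟩ | ⟨e, f⟩ | ⟨e, f⟩ | ⟨e, f⟩ | ⟨e, f⟩ |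
      ⟨e, f⟩ | ⟨e, f⟩ | ⟨e, f⟩ | ⟨e, f⟩ <;>
      rw [e, f] <;> simp only [h1, h4, h1', h2', h4', ← hx] <;> assumption
  · exact posSemidef_smul_ketProj (by positivity) _
  · exact smul_ketProj_mulVec_eq_zero _ (by rw [star_phaseKet_dotProduct, if_neg (by decide)])
  · simp only [trace_phasePointOne_mul_add]
    rw [Fintype.sum_prod_type_right]
    have c1 : |(1 + x)⁻¹ * ((1 + (2 - x - x ^ 2)) / 3) + (1 + x)⁻¹ * x * ((1 + x) / 3)| =
        (1 + x)⁻¹ := by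
      rw [show (1 + x)⁻¹ * ((1 + (2 - x - x ^ 2)) / 3) + (1 + x)⁻¹ * x * ((1 + x) / 3) =
        (1 + x)⁻¹ by ring, abs_of_pos ha0]
    have c2 : |(1 + x)⁻¹ * ((1 + (x ^ 2 - 2)) / 3) + (1 + x)⁻¹ * x * ((1 + (2 - x - x ^ 2)) / 3)| =
        0 := by
      rw [abs_eq_zero]
      linear_combination -(1 + x)⁻¹ / 3 * hx3
    have c3 : |(1 + x)⁻¹ * ((1 + x) / 3) + (1 + x)⁻¹ * x * ((1 + (x ^ 2 - 2)) / 3)| =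
        (1 + x)⁻¹ * x := by
      rw [show (1 + x)⁻¹ * ((1 + x) / 3) + (1 + x)⁻¹ * x * ((1 + (x ^ 2 - 2)) / 3) =
        (1 + x)⁻¹ * x by linear_combination (1 + x)⁻¹ / 3 * hx3, abs_of_pos (by positivity)]
    simp only [sum_zmod_three,
      show phaseSpaceExp 0 (0, 0) = 1 by decide, show phaseSpaceExp 0 (1, 0) = 4 by decide,
      show phaseSpaceExp 0 (2, 0) = -2 by decide, show phaseSpaceExp 0 (0, 1) = -2 by decide,
      show phaseSpaceExp 0 (1, 1) = 1 by decide, show phaseSpaceExp 0 (2, 1) = 4 by decide,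
      show phaseSpaceExp 0 (0, 2) = 1 by decide, show phaseSpaceExp 0 (1, 2) = 4 by decide,
      show phaseSpaceExp 0 (2, 2) = -2 by decide,
      show phaseSpaceExp 1 (0, 0) = -2 by decide, show phaseSpaceExp 1 (1, 0) = 1 by decide,
      show phaseSpaceExp 1 (2, 0) = 4 by decide, show phaseSpaceExp 1 (0, 1) = 4 by decide,
      show phaseSpaceExp 1 (1, 1) = -2 by decide, show phaseSpaceExp 1 (2, 1) = 1 by decide,
      show phaseSpaceExp 1 (0, 2) = -2 by decide, show phaseSpaceExp 1 (1, 2) = 1 by decide,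
      show phaseSpaceExp 1 (2, 2) = 4 by decide, h1, h2', h4, c1, c2, c3]
    apply le_of_eq
    field_simp
    ring

end PhaseKets

/-! ### Stabilizer states have non-positive mana -/

section Stabilizer

/-- The standard additive character of `ℤ/3`. -/
local notation "χ" => (ZMod.stdAddChar : AddChar (ZMod 3) ℂ)

/-- The symplectic form on the discrete phase space. -/
def sympForm {n : ℕ} (u v : PhaseSpace 3 n) : ZMod 3 :=
  ∑ k, ((v k).1 * (u k).2 - (u k).1 * (v k).2)

lemma sympForm_add_right {n : ℕ} (u v w : PhaseSpace 3 n) :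
    sympForm u (v + w) = sympForm u v + sympForm u w := by
  rw [sympForm, sympForm, sympForm, ← Finset.sum_add_distrib]
  refine Finset.sum_congr rfl fun k _ => ?_
  simp only [Pi.add_apply, Prod.fst_add, Prod.snd_add]
  ring

lemma sympForm_swap {n : ℕ} (u v : PhaseSpace 3 n) : sympForm u v = -sympForm v u := by
  rw [sympForm, sympForm, ← Finset.sum_neg_distrib]
  refine Finset.sum_congr rfl fun k _ => ?_
  ring

lemma stdAddChar_sum {n : ℕ} (f : Fin n → ZMod 3) : χ (∑ k, f k) = ∏ k, χ (f k) :=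
  map_prod (AddChar.toMonoidHom χ) (fun k => Multiplicative.ofAdd (f k)) Finset.univ

lemma weylOne_mul_weylOne (u v : ZMod 3 × ZMod 3) :
    weylOne 3 u * weylOne 3 v = χ (v.1 * u.2 - u.1 * v.2) • weylOne 3 (u + v) := by
  ext i j
  rw [weylOne_mul_apply, Matrix.smul_apply, weylOne_apply, weylOne_apply]
  have h : (i - u.2 = j + v.2) = (i = j + (u + v).2) := by
    rw [eq_iff_iff, sub_eq_iff_eq_add, Prod.snd_add, add_assoc, add_comm v.2]
  have h3 : (3 : ZMod 3) = 0 := rfl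
  simp only [h, smul_eq_mul, mul_ite, mul_zero, ← AddChar.map_add_eq_mul, Prod.fst_add,
    Prod.snd_add]
  congr 2
  linear_combination (-v.1 * u.2) * h3

/-- The phase in T_u makes the cocycle antisymmetric, so commuting Heisenberg-Weyl operators
multiply with no phase at all. -/
lemma weyl_mul_weyl {n : ℕ} (u v : PhaseSpace 3 n) :
    weyl u * weyl v = χ (sympForm u v) • weyl (u + v) := by
  simp only [weyl_eq_tensorProd, tensorProd_mul, weylOne_mul_weylOne, sympForm]
  rw [stdAddChar_sum, tensorProd_smul]
  rfl

lemma trace_phasePointOne_mul_weylOne (u v : ZMod 3 × ZMod 3) :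
    (phasePointOne u * weylOne 3 v).trace = χ (v.1 * u.2 - u.1 * v.2) := by
  have h3 : (3 : ZMod 3) = 0 := rfl
  simp only [Matrix.trace, Matrix.diag]
  -- A reflection about u.2 composed with a shift by v.2 has one fixed point, u.2 - v.2/2 = u.2 +
  -- v.2 modulo 3.
  rw [Finset.sum_eq_single (u.2 + v.2)]
  · rw [Matrix.mul_apply, Finset.sum_eq_single (u.2 + 2 * v.2)]
    · rw [phasePointOne_apply, weylOne_apply, if_pos, if_pos, ← AddChar.map_add_eq_mul]
      · congr 1
        linear_combination (v.1 * v.2) * h3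
      · ring
      · linear_combination v.2 * h3
    · intro j _ hj
      rw [weylOne_apply, if_neg, mul_zero]
      intro h
      apply hj
      linear_combination h
    · simp
  · intro i _ hi
    rw [Matrix.mul_apply]
    refine Finset.sum_eq_zero fun j _ => ?_
    rw [phasePointOne_apply, weylOne_apply]
    split_ifs with h1 h2
    · exfalso
      apply hi
      linear_combination 2 * (h1 - h2) + (-i + u.2 - v.2) * h3
    all_goals simp
  · simp

lemma trace_phasePoint_mul_weyl {n : ℕ} (u v : PhaseSpace 3 n) :
    (phasePoint u * weyl v).trace = χ (sympForm u v) := by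
  rw [weyl_eq_tensorProd, trace_phasePoint_mul_tensorProd, sympForm, stdAddChar_sum]
  simp only [trace_phasePointOne_mul_weylOne]

lemma sum_weylOne_boost :
    (3 : ℂ)⁻¹ • ∑ a : ZMod 3, weylOne 3 (a, 0) = Matrix.single 0 0 1 := by
  ext i j
  simp only [Matrix.smul_apply, Matrix.sum_apply, weylOne_apply, add_zero, zero_add]
  rw [Matrix.single_apply]
  by_cases hij : i = j
  · subst hij
    simp only [if_true, sum_stdAddChar_mul, eq_comm (a := (0 : ZMod 3)), and_self]
    split_ifs <;> simp
  · rw [if_neg fun h => hij (h.1.symm.trans h.2)]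
    simp [hij]

/-- The phase-space points of the boost operators. -/
def boostPoint {n : ℕ} (a : Fin n → ZMod 3) : PhaseSpace 3 n := fun k => (a k, 0)

lemma projZero_eq_sum_weyl (n : ℕ) :
    projZero 3 n = ((3 : ℂ) ^ n)⁻¹ • ∑ a : Fin n → ZMod 3, weyl (boostPoint a) := by
  rw [← tensorProd_single_zero]
  simp_rw [← sum_weylOne_boost]
  rw [tensorProd_smul, tensorProd_sum]
  simp [weyl_eq_tensorProd, boostPoint]

lemma weyl_boostPoint_mul {n : ℕ} (a b : Fin n → ZMod 3) :
    weyl (boostPoint a) * weyl (boostPoint b) = weyl (boostPoint (a + b)) := by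
  rw [weyl_mul_weyl]
  have h : sympForm (boostPoint a) (boostPoint b) = 0 := by simp [sympForm, boostPoint]
  rw [h, AddChar.map_zero_eq_one, one_smul]
  refine congrArg weyl (funext fun k => Prod.ext rfl ?_)
  exact add_zero _

lemma weyl_zero {n : ℕ} : weyl (0 : PhaseSpace 3 n) = 1 := by
  rw [weyl_eq_tensorProd, ← tensorProd_one]
  congr 1
  ext k i j
  rw [weylOne_apply, Matrix.one_apply]
  simp

lemma trace_phasePoint_one {n : ℕ} (u : PhaseSpace 3 n) : (phasePoint u).trace = 1 := by
  have h := trace_phasePoint_mul_weyl u 0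
  rw [weyl_zero, Matrix.mul_one] at h
  rw [h]
  simp [sympForm]

/-- The phase-space expectations of a commuting pair of multiples of Heisenberg-Weyl operators
are multiplicative. -/
lemma trace_phasePoint_mul_mul {n : ℕ} {E F : QOp 3 n} {c d : ℂ} {v w : PhaseSpace 3 n}
    (hE : E = c • weyl v) (hF : F = d • weyl w) (hc : c ≠ 0) (hd : d ≠ 0) (hEF : E * F = F * E)
    (u : PhaseSpace 3 n) :
    (phasePoint u * (E * F)).trace = (phasePoint u * E).trace * (phasePoint u * F).trace := by
  have hmul : ∀ (c d : ℂ) (v w : PhaseSpace 3 n),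
      (c • weyl v) * (d • weyl w) = (c * d * χ (sympForm v w)) • weyl (v + w) := by
    intro c d v w
    rw [Matrix.smul_mul, Matrix.mul_smul, weyl_mul_weyl, smul_smul, smul_smul, mul_assoc]
  subst hE hF
  rw [hmul, hmul] at hEF
  have h1 : χ (sympForm v w) = χ (-sympForm v w) := by
    have := congrArg (fun M => (phasePoint 0 * M).trace) hEF
    simp only [Matrix.mul_smul, Matrix.trace_smul, trace_phasePoint_mul_weyl, smul_eq_mul] at this
    rw [add_comm w v, sympForm_swap w v, mul_comm d c] at this
    have h0 : χ (sympForm 0 (v + w)) ≠ 0 := by simp [sympForm]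
    exact mul_left_cancel₀ (mul_ne_zero hc hd) (mul_right_cancel₀ h0 this)
  -- Commutation gives s = -s for the symplectic product s, and 2 is invertible modulo 3.
  have h2 : sympForm v w = 0 := by
    have h3 := ZMod.injective_stdAddChar h1
    generalize sympForm v w = x at h3
    clear h1 hEF
    revert x
    decide
  rw [hmul, h2, AddChar.map_zero_eq_one, mul_one]
  simp only [Matrix.mul_smul, Matrix.trace_smul, trace_phasePoint_mul_weyl, smul_eq_mul,
    sympForm_add_right, AddChar.map_add_eq_mul]
  ring

/-- Pure stabilizer states have a non-negative Wigner function. -/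
lemma wigner_stabilizer_nonneg {n : ℕ} {U : QOp 3 n} (hU : IsClifford U) (u : PhaseSpace 3 n) :
    0 ≤ wigner (U * projZero 3 n * Uᴴ) u := by
  have hUU : Uᴴ * U = 1 := Matrix.mem_unitaryGroup_iff'.mp hU.1
  have hUU' : U * Uᴴ = 1 := Matrix.mem_unitaryGroup_iff.mp hU.1
  choose θ f hf using fun a : Fin n → ZMod 3 => hU.2 (boostPoint a)
  have hmul : ∀ a b, (U * weyl (boostPoint a) * Uᴴ) * (U * weyl (boostPoint b) * Uᴴ) =
      U * weyl (boostPoint (a + b)) * Uᴴ := by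
    intro a b
    rw [← weyl_boostPoint_mul]
    calc _ = U * weyl (boostPoint a) * (Uᴴ * U) * weyl (boostPoint b) * Uᴴ := by
          simp only [Matrix.mul_assoc]
      _ = _ := by rw [hUU, Matrix.mul_one]; simp only [Matrix.mul_assoc]
  -- Conjugation by U keeps the boosts a commuting group of phased Heisenberg-Weyl operators, on
  -- which the expectation of A_u is multiplicative. The Wigner function is a positive multiple of
  -- the sum of this character, which is 0 or the group order.
  let g : AddChar (Fin n → ZMod 3) ℂ :=
    { toFun := fun a => (phasePoint u * (U * weyl (boostPoint a) * Uᴴ)).trace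
      map_zero_eq_one' := by
        have h0 : boostPoint (0 : Fin n → ZMod 3) = 0 := rfl
        rw [h0, weyl_zero, Matrix.mul_one, hUU', Matrix.mul_one, trace_phasePoint_one]
      map_add_eq_mul' := fun a b => by
        rw [← hmul]
        refine trace_phasePoint_mul_mul (hf a) (hf b) (Complex.exp_ne_zero _)
          (Complex.exp_ne_zero _) ?_ u
        rw [hmul, hmul, add_comm] }
  have hw : wigner (U * projZero 3 n * Uᴴ) u = ((3 : ℂ) ^ n)⁻¹ * ((3 : ℂ) ^ n)⁻¹ * ∑ a, g a := by
    change _ = _ * ∑ a, (phasePoint u * (U * weyl (boostPoint a) * Uᴴ)).trace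
    rw [wigner, projZero_eq_sum_weyl, Matrix.mul_smul, Matrix.smul_mul, Matrix.mul_smul,
      Matrix.trace_smul, Matrix.mul_sum, Matrix.sum_mul, Matrix.mul_sum, Matrix.trace_sum,
      smul_eq_mul]
    push_cast
    field_simp
  classical
  rw [hw, AddChar.sum_eq_ite]
  have h3 : (0 : ℂ) ≤ ((3 : ℂ) ^ n)⁻¹ := inv_nonneg.mpr (pow_nonneg (by norm_num) n)
  refine mul_nonneg (mul_nonneg h3 h3) ?_
  split_ifs
  · exact Nat.cast_nonneg _
  · exact le_rfl

lemma stabStates_subset_nonposMana (n : ℕ) : stabStates 3 n ⊆ nonposMana 3 n := by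
  refine convexHull_min ?_ convex_nonposMana
  rintro S ⟨U, hU, rfl⟩
  have hproj : (projZero 3 n).PosSemidef := by
    rw [← tensorProd_single_zero]
    refine posSemidef_tensorProd fun _ => ?_
    have : (Matrix.single 0 0 1 : Matrix (ZMod 3) (ZMod 3) ℂ) =
        vecMulVec (Pi.single 0 1) (star (Pi.single 0 1)) := by
      rw [Matrix.single_eq_single_vecMulVec_single]
      congr 1
      ext i
      by_cases hi : i = 0
      · subst hi; simp
      · simp [hi]
    rw [this]
    exact posSemidef_vecMulVec_self_star _
  refine ⟨(mana_nonpos_iff _).mpr (le_of_eq ?_), hproj.mul_mul_conjTranspose_same U⟩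
  -- For a non-negative Wigner function the norm is the plain sum, which is the trace.
  have h1 : (wignerTraceNorm (U * projZero 3 n * Uᴴ) : ℂ) = 1 := by
    rw [wignerTraceNorm]
    push_cast
    refine (Finset.sum_congr rfl fun u _ =>
      (Complex.eq_coe_norm_of_nonneg (wigner_stabilizer_nonneg hU u)).symm).trans ?_
    rw [sum_wigner, Matrix.trace_mul_comm, ← Matrix.mul_assoc,
      ← Matrix.star_eq_conjTranspose, Matrix.mem_unitaryGroup_iff'.mp hU.1, Matrix.one_mul]
    exact Matrix.trace_single_eq_same (n := Fin n → ZMod 3) 0 1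
  exact_mod_cast h1

end Stabilizer

/-! ### Stabilizer decompositions of the optimal operators -/

section Clifford

/-- The standard additive character of `ℤ/3`. -/
local notation "χ" => (ZMod.stdAddChar : AddChar (ZMod 3) ℂ)

/-- One-qutrit Clifford operators, by their commutation with Heisenberg-Weyl operators. -/
def IsCliffordOne (U : Matrix (ZMod 3) (ZMod 3) ℂ) : Prop :=
  U * Uᴴ = 1 ∧ ∀ u, ∃ (x : ZMod 3) (u' : ZMod 3 × ZMod 3), U * weylOne 3 u = χ x • (weylOne 3 u' * U)

lemma IsCliffordOne.mul {U V : Matrix (ZMod 3) (ZMod 3) ℂ} (hU : IsCliffordOne U)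
    (hV : IsCliffordOne V) : IsCliffordOne (U * V) := by
  constructor
  · rw [Matrix.conjTranspose_mul, Matrix.mul_assoc, ← Matrix.mul_assoc V, hV.1, Matrix.one_mul, hU.1]
  · intro u
    obtain ⟨x, v, h⟩ := hV.2 u
    obtain ⟨y, w, h'⟩ := hU.2 v
    refine ⟨x + y, w, ?_⟩
    rw [Matrix.mul_assoc, h, Matrix.mul_smul, ← Matrix.mul_assoc, h', Matrix.smul_mul, smul_smul,
      AddChar.map_add_eq_mul, Matrix.mul_assoc]

lemma exists_exp_eq_stdAddChar (x : ZMod 3) : ∃ θ : ℝ, Complex.exp (Complex.I * θ) = χ x := by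
  have h : ‖χ x‖ = 1 := by
    rw [ZMod.stdAddChar_apply]
    exact Circle.norm_coe _
  refine ⟨(χ x).arg, ?_⟩
  have h1 := Complex.norm_mul_exp_arg_mul_I (χ x)
  rwa [h, Complex.ofReal_one, one_mul, mul_comm] at h1

lemma isClifford_tensorProd {n : ℕ} {U : Fin n → Matrix (ZMod 3) (ZMod 3) ℂ}
    (hU : ∀ k, IsCliffordOne (U k)) : IsClifford (tensorProd U) := by
  constructor
  · rw [Matrix.mem_unitaryGroup_iff, Matrix.star_eq_conjTranspose, conjTranspose_tensorProd,
      tensorProd_mul, ← tensorProd_one]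
    simp_rw [fun k => (hU k).1]
  · intro u
    choose x v h using fun k => (hU k).2 (u k)
    obtain ⟨θ, hθ⟩ := exists_exp_eq_stdAddChar (∑ k, x k)
    refine ⟨θ, v, ?_⟩
    rw [weyl_eq_tensorProd, weyl_eq_tensorProd, conjTranspose_tensorProd, tensorProd_mul,
      tensorProd_mul, hθ, stdAddChar_sum, ← tensorProd_smul]
    congr 1
    ext1 k
    rw [h, Matrix.smul_mul, Matrix.mul_assoc, (hU k).1, Matrix.mul_one]

/-- The one-qutrit state `U|0⟩⟨0|U†`. -/
def rotatedZero (U : Matrix (ZMod 3) (ZMod 3) ℂ) : Matrix (ZMod 3) (ZMod 3) ℂ :=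
  U * Matrix.single 0 0 1 * Uᴴ

/-- Tensor powers of mixtures of one-qutrit stabilizer states are mixtures of stabilizer states. -/
lemma tensorPow_sum_mem_stabStates {ι : Type*} [Fintype ι] {p : ι → ℝ}
    {U : ι → Matrix (ZMod 3) (ZMod 3) ℂ} (hp : ∀ i, 0 ≤ p i) (hp1 : ∑ i, p i = 1)
    (hU : ∀ i, IsCliffordOne (U i)) (n : ℕ) :
    tensorPow (∑ i, (p i : ℂ) • rotatedZero (U i)) n ∈ stabStates 3 n := by
  rw [tensorPow_eq_tensorProd, tensorProd_sum]
  -- Expanding the power gives product stabilizer states, weighted by a product distribution.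
  have h : ∀ f : Fin n → ι,
      (tensorProd fun k => (p (f k) : ℂ) • rotatedZero (U (f k))) =
        (∏ k, p (f k)) • ((tensorProd fun k => U (f k)) * projZero 3 n *
          (tensorProd fun k => U (f k))ᴴ) := by
    intro f
    rw [tensorProd_smul, ← tensorProd_single_zero, conjTranspose_tensorProd, tensorProd_mul,
      tensorProd_mul, ← Complex.coe_smul]
    push_cast
    rfl
  simp only [h]
  refine (convex_convexHull ℝ _).sum_mem (fun f _ => Finset.prod_nonneg fun k _ => hp _) ?_
    fun f _ => subset_convexHull ℝ _ ⟨_, isClifford_tensorProd fun k => hU (f k), rfl⟩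
  rw [← Fintype.prod_sum fun (_ : Fin n) i => p i, hp1]
  simp

/-! ### One-qutrit Clifford gates -/

lemma mul_weylOne_apply (u : ZMod 3 × ZMod 3) (M : Matrix (ZMod 3) (ZMod 3) ℂ) (i j : ZMod 3) :
    (M * weylOne 3 u) i j = M i (j + u.2) * χ (u.1 * (u.2 + (j + u.2))) := by
  rw [Matrix.mul_apply, Finset.sum_eq_single (j + u.2)]
  · rw [weylOne_apply, if_pos rfl]
  · intro b _ hb
    rw [weylOne_apply, if_neg hb, mul_zero]
  · simp

lemma isCliffordOne_one : IsCliffordOne 1 :=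
  ⟨by simp, fun u => ⟨0, u, by simp⟩⟩

lemma isCliffordOne_weylOne (v : ZMod 3 × ZMod 3) : IsCliffordOne (weylOne 3 v) := by
  constructor
  · ext i j
    rw [mul_weylOne_conjTranspose_apply, weylOne_apply, Matrix.one_apply]
    simp only [sub_add_cancel]
    split_ifs with h
    · rw [h, ← AddChar.map_add_eq_mul, add_neg_cancel, AddChar.map_zero_eq_one]
    · simp
  · intro u
    refine ⟨(u.1 * v.2 - v.1 * u.2) - (v.1 * u.2 - u.1 * v.2), u, ?_⟩
    rw [weylOne_mul_weylOne, weylOne_mul_weylOne, smul_smul, ← AddChar.map_add_eq_mul, add_comm u v]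
    congr 2
    ring

lemma hadamard3_apply (i j : ZMod 3) :
    hadamard3 i j = ((Real.sqrt 3 : ℝ) : ℂ)⁻¹ * χ (i * j) := by
  have h : omega 3 ^ (i.val * j.val) = χ (i * j) := by
    rw [pow_mul, omega_pow_val, ← AddChar.map_nsmul_eq_pow, nsmul_eq_mul, mul_comm,
      ZMod.natCast_zmod_val]
  rw [hadamard3, Matrix.smul_apply, Matrix.of_apply, h, smul_eq_mul]

lemma inv_sqrt_three_mul_self :
    ((Real.sqrt 3 : ℝ) : ℂ)⁻¹ * ((Real.sqrt 3 : ℝ) : ℂ)⁻¹ = 3⁻¹ := by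
  rw [← mul_inv, ← Complex.ofReal_mul, sqrt_three_sq]
  norm_num

lemma isCliffordOne_hadamard3 : IsCliffordOne hadamard3 := by
  have h3 : (3 : ZMod 3) = 0 := rfl
  constructor
  · ext i j
    have h : ∀ k, hadamard3 i k * hadamard3ᴴ k j = 3⁻¹ * χ (k * (i - j)) := by
      intro k
      rw [Matrix.conjTranspose_apply, hadamard3_apply, hadamard3_apply, star_mul', conj_stdAddChar,
        mul_sub, sub_eq_add_neg, AddChar.map_add_eq_mul, ← inv_sqrt_three_mul_self, mul_comm k,
        mul_comm k]
      simp only [star_inv₀, RCLike.star_def, Complex.conj_ofReal]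
      ring
    rw [Matrix.mul_apply]
    simp only [h]
    rw [← Finset.mul_sum, sum_stdAddChar_mul, Matrix.one_apply]
    simp only [sub_eq_zero]
    split_ifs <;> simp
  · intro u
    -- The Fourier transform exchanges boosts and shifts: a quarter turn of phase space.
    refine ⟨0, (u.2, -u.1), ?_⟩
    ext i j
    rw [AddChar.map_zero_eq_one, one_smul, mul_weylOne_apply, weylOne_mul_apply, hadamard3_apply,
      hadamard3_apply, mul_assoc, mul_left_comm (χ _), ← AddChar.map_add_eq_mul,
      ← AddChar.map_add_eq_mul]
    congr 2
    simp only
    linear_combination (u.1 * u.2) * h3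

/-- Diagonal Clifford gates with a quadratic phase. -/
noncomputable def phaseGate (t : ZMod 3) : Matrix (ZMod 3) (ZMod 3) ℂ :=
  Matrix.diagonal fun j => χ (t * (j ^ 2 + j))

lemma isCliffordOne_phaseGate (t : ZMod 3) : IsCliffordOne (phaseGate t) := by
  have h3 : (3 : ZMod 3) = 0 := rfl
  constructor
  · rw [phaseGate, Matrix.diagonal_conjTranspose, Matrix.diagonal_mul_diagonal, ← Matrix.diagonal_one]
    congr 1
    ext j
    rw [Pi.star_apply, conj_stdAddChar, ← AddChar.map_add_eq_mul, add_neg_cancel,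
      AddChar.map_zero_eq_one]
  · intro u
    -- A quadratic phase acts as a shear: differencing it along a shift leaves a boost and a
    -- constant phase.
    refine ⟨t * u.2, (u.1 + 2 * t * u.2, u.2), ?_⟩
    ext i j
    rw [phaseGate, Matrix.diagonal_mul, Matrix.smul_apply, Matrix.mul_diagonal, weylOne_apply,
      weylOne_apply]
    split_ifs with h
    · rw [smul_eq_mul, ← AddChar.map_add_eq_mul, ← AddChar.map_add_eq_mul,
        ← AddChar.map_add_eq_mul]
      subst h
      congr 1
      linear_combination (-t * u.2 ^ 2) * h3
    · simp

lemma rotatedZero_apply (U : Matrix (ZMod 3) (ZMod 3) ℂ) (i j : ZMod 3) :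
    rotatedZero U i j = U i 0 * star (U j 0) := by
  rw [rotatedZero, Matrix.mul_apply, Finset.sum_eq_single 0]
  · rw [Matrix.mul_single_apply_same, mul_one, Matrix.conjTranspose_apply]
  · intro k _ hk
    rw [Matrix.mul_single_apply_of_ne _ _ _ _ _ hk, zero_mul]
  · simp

lemma rotatedZero_phaseGate_mul_hadamard3_apply (t i j : ZMod 3) :
    rotatedZero (phaseGate t * hadamard3) i j =
      3⁻¹ * χ (t * (i ^ 2 + i - (j ^ 2 + j))) := by
  rw [rotatedZero_apply, phaseGate, Matrix.diagonal_mul, Matrix.diagonal_mul,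
    hadamard3_apply, hadamard3_apply, mul_zero, mul_zero, AddChar.map_zero_eq_one, mul_one,
    star_mul', conj_stdAddChar, mul_sub, sub_eq_add_neg, AddChar.map_add_eq_mul,
    ← inv_sqrt_three_mul_self]
  simp only [star_inv₀, RCLike.star_def, Complex.conj_ofReal]
  ring

lemma rotatedZero_shift_apply (i j : ZMod 3) :
    rotatedZero (weylOne 3 (0, 1)) i j = ((if i = 1 ∧ j = 1 then 1 else 0 : ℝ) : ℂ) := by
  rw [rotatedZero_apply, weylOne_apply, weylOne_apply, zero_add, ite_and]
  split_ifs <;> simp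

lemma rotatedZero_one_apply (i j : ZMod 3) :
    rotatedZero 1 i j = ((if i = 0 ∧ j = 0 then 1 else 0 : ℝ) : ℂ) := by
  rw [rotatedZero_apply, Matrix.one_apply, Matrix.one_apply, ite_and]
  split_ifs <;> simp

lemma symmEntries_eq_iff {a b c x y z : ℝ} {f : ZMod 3 → ZMod 3 → ℝ} :
    (∀ i j, symmEntries a b c x y z i j = f i j) ↔
      ((a = f 0 0 ∧ z = f 0 1 ∧ y = f 0 2) ∧ (z = f 1 0 ∧ b = f 1 1 ∧ x = f 1 2) ∧
        y = f 2 0 ∧ x = f 2 1 ∧ c = f 2 2) := by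
  simp only [forall_zmod_three]
  exact Iff.rfl

lemma inv_three_eq_ofReal : (3⁻¹ : ℂ) = ((3⁻¹ : ℝ) : ℂ) := by norm_num

lemma symmOp_apply (a b c x y z : ℝ) (i j : ZMod 3) :
    symmOp a b c x y z i j = ((symmEntries a b c x y z i j : ℝ) : ℂ) := rfl

/-- The optimal operator is the uniform mixture of |1⟩ and the two states with quadratic phases t =
1, 2 on the uniform superposition. -/
lemma tensorPow_norrell_mem_stabStates (n : ℕ) :
    tensorPow (((2 / 3 : ℝ) : ℂ) • ketProj ketNorrell +
      ((1 / 9 : ℝ) : ℂ) • ketProj (qutritKet (1 : ℝ) (1 : ℝ) (1 : ℝ))) n ∈ stabStates 3 n := by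
  have h := tensorPow_sum_mem_stabStates (p := fun _ : ZMod 3 => 1 / 3)
    (U := fun i => if i = 0 then weylOne 3 (0, 1) else phaseGate i * hadamard3)
    (fun _ => by norm_num) (by rw [sum_zmod_three]; norm_num) (fun i => by
      split_ifs
      exacts [isCliffordOne_weylOne _, (isCliffordOne_phaseGate i).mul isCliffordOne_hadamard3]) n
  convert h using 2
  rw [smul_ketProj_ketNorrell_add, sum_zmod_three, if_pos rfl, if_neg (by decide),
    if_neg (by decide)]
  ext i j
  have hs := stdAddChar_add_neg (i ^ 2 + i - (j ^ 2 + j))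
  -- As 2 = -1 modulo 3, the two phase states have complex conjugate entries, and their sum is real.
  have h2 : 2 * (i ^ 2 + i - (j ^ 2 + j)) = -(i ^ 2 + i - (j ^ 2 + j)) := by
    have h3 : (3 : ZMod 3) = 0 := rfl
    linear_combination (i ^ 2 + i - (j ^ 2 + j)) * h3
  simp only [Matrix.add_apply, Matrix.smul_apply, rotatedZero_phaseGate_mul_hadamard3_apply,
    rotatedZero_shift_apply, smul_eq_mul, one_mul, h2]
  rw [add_assoc, ← mul_add, ← mul_add, ← mul_add, hs, symmOp_apply, inv_three_eq_ofReal,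
    ← Complex.ofReal_mul, ← Complex.ofReal_add, ← Complex.ofReal_mul]
  refine congrArg _ ?_
  clear hs h2 h
  revert i j
  rw [symmEntries_eq_iff]
  refine ⟨⟨?_, ?_, ?_⟩, ⟨?_, ?_, ?_⟩, ?_, ?_, ?_⟩
  all_goals
    first
    | rw [if_pos (by decide), if_pos (by decide)]
    | rw [if_neg (by decide), if_pos (by decide)]
    | rw [if_neg (by decide), if_neg (by decide)]
    norm_num

/-- The optimal operator is the even mixture of |0⟩ and its Hadamard image; the trivial gate
`phaseGate 0` lets the entry formula for phase states apply. -/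
lemma tensorPow_hPlus_mem_stabStates (n : ℕ) :
    tensorPow ((((3 + Real.sqrt 3) / 6 : ℝ) : ℂ) • ketProj ketHPlus +
      (((2 - Real.sqrt 3) / 24 : ℝ) : ℂ) •
        ketProj (qutritKet (-2 : ℝ) (1 + Real.sqrt 3 : ℝ) (1 + Real.sqrt 3 : ℝ))) n ∈
      stabStates 3 n := by
  have h := tensorPow_sum_mem_stabStates (p := fun _ : Bool => 1 / 2)
    (U := fun i => if i then 1 else phaseGate 0 * hadamard3)
    (fun _ => by norm_num) (by simp) (fun i => by
      split_ifs
      exacts [isCliffordOne_one, (isCliffordOne_phaseGate 0).mul isCliffordOne_hadamard3]) n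
  convert h using 2
  rw [smul_ketProj_ketHPlus_add, Fintype.sum_bool, if_pos rfl, if_neg (by decide)]
  ext i j
  simp only [Matrix.add_apply, Matrix.smul_apply, rotatedZero_phaseGate_mul_hadamard3_apply,
    rotatedZero_one_apply, smul_eq_mul, zero_mul, AddChar.map_zero_eq_one, mul_one]
  rw [symmOp_apply, inv_three_eq_ofReal, ← Complex.ofReal_mul, ← Complex.ofReal_mul,
    ← Complex.ofReal_add]
  refine congrArg _ ?_
  clear h
  revert i j
  rw [symmEntries_eq_iff]
  refine ⟨⟨?_, ?_, ?_⟩, ⟨?_, ?_, ?_⟩, ?_, ?_, ?_⟩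
  all_goals
    first
    | rw [if_pos (by decide)]
    | rw [if_neg (by decide)]
    norm_num

end Clifford

lemma inv_three_add_sqrt_three_div_six :
    ((3 + Real.sqrt 3) / 6)⁻¹ = 3 - Real.sqrt 3 := by
  refine inv_eq_of_mul_eq_one_right ?_
  linear_combination -sqrt_three_sq / 6

theorem proposition2 :
    (thaumaMin (tensorPow (ketProj ketStrange) 1) = ((Real.logb 2 (5 / 3) : ℝ) : EReal) ∧
      HasRegThauma (ketProj ketStrange) ((Real.logb 2 (5 / 3) : ℝ) : EReal) ∧
      thaumaMax (tensorPow (ketProj ketStrange) 1) = ((Real.logb 2 (5 / 3) : ℝ) : EReal)) ∧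
    (thaumaMin (tensorPow (ketProj ketNorrell) 1) = ((Real.logb 2 (3 / 2) : ℝ) : EReal) ∧
      HasRegThauma (ketProj ketNorrell) ((Real.logb 2 (3 / 2) : ℝ) : EReal) ∧
      thaumaMax (tensorPow (ketProj ketNorrell) 1) = ((Real.logb 2 (3 / 2) : ℝ) : EReal) ∧
      HasRegRelEntropyMagic (ketProj ketNorrell) ((Real.logb 2 (3 / 2) : ℝ) : EReal)) ∧
    (thaumaMin (tensorPow (ketProj ketHPlus) 1) = ((Real.logb 2 (3 - Real.sqrt 3) : ℝ) : EReal) ∧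
      HasRegThauma (ketProj ketHPlus) ((Real.logb 2 (3 - Real.sqrt 3) : ℝ) : EReal) ∧
      thaumaMax (tensorPow (ketProj ketHPlus) 1) =
        ((Real.logb 2 (3 - Real.sqrt 3) : ℝ) : EReal) ∧
      HasRegRelEntropyMagic (ketProj ketHPlus)
        ((Real.logb 2 (3 - Real.sqrt 3) : ℝ) : EReal)) ∧
    (thaumaMin (tensorPow (ketProj ketT) 1) =
        ((Real.logb 2 (1 + 2 * Real.sin (Real.pi / 18)) : ℝ) : EReal) ∧
      HasRegThauma (ketProj ketT)
        ((Real.logb 2 (1 + 2 * Real.sin (Real.pi / 18)) : ℝ) : EReal) ∧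
      thaumaMax (tensorPow (ketProj ketT) 1) =
        ((Real.logb 2 (1 + 2 * Real.sin (Real.pi / 18)) : ℝ) : EReal)) := by
  obtain ⟨s1, s2, s3⟩ := isThaumaWitness_ketStrange.thauma_equalities (b := 5 / 3) (by norm_num)
  obtain ⟨n1, n2, n3⟩ := isThaumaWitness_ketNorrell.thauma_equalities (b := 3 / 2) (by norm_num)
  obtain ⟨h1, h2, h3⟩ :=
    isThaumaWitness_ketHPlus.thauma_equalities inv_three_add_sqrt_three_div_six
  obtain ⟨t1, t2, t3⟩ := isThaumaWitness_ketT.thauma_equalities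
    (b := 1 + 2 * Real.sin (Real.pi / 18)) (by rw [inv_inv, twoCos_two])
  have n4 := isThaumaWitness_ketNorrell.hasRegRelEntropyMagic stabStates_subset_nonposMana
    tensorPow_norrell_mem_stabStates
  have h4 := isThaumaWitness_ketHPlus.hasRegRelEntropyMagic stabStates_subset_nonposMana
    tensorPow_hPlus_mem_stabStates
  rw [inv_three_add_sqrt_three_div_six] at h4
  rw [show ((2 : ℝ) / 3)⁻¹ = 3 / 2 by norm_num] at n4
  exact ⟨⟨s1, s2, s3⟩, ⟨n1, n2, n3, n4⟩, ⟨h1, h2, h3, h4⟩, t1, t2, t3⟩
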